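/- Let $k$ be an algebraically closed field, $X$ a smooth projective variety over $k$, $L$ a line bundle on $X$ such that $L^{-1}$ is ample, and $E_1,\dots,E_n$ ($n\ge 1$) a collection of line bundles on $X$. Suppose that it is a full, strong, exceptional collection, that is, $\operatorname{End}(E_i)=k$, $\operatorname{Hom}(E_i,E_j)=0$ for $i>j$, $\operatorname{Ext}^m(E_i,E_j)=0$ for all $i,j$ and all $m\ne 0$, and every nonzero object of the derived category of coherent sheaves on $X$ receives a nonzero morphism from a shift of some $E_i$. Suppose moreover that it generates a simple spiral with respect to $L$: if it is extended to all integer indices by $E_{i-n}=E_i\otimes L$, then $\operatorname{Ext}^m_X(E_i,E_j)=0$ for all $m\neq 0$ and all $i\le j$. Let $\pi:V\to X$ be the total space of $L$, and let $V_0=\operatorname{Spec}\Gamma(V,\mathcal O_V)$. Let $\mathbf Q$ be a quiver with relations, with nodes $1,\dots,n$, whose path algebra is $A=\operatorname{End}_V(\bigoplus_i\pi^*E_i)^{\mathrm{op}}$ (for instance the Bondal quiver of $\pi^*E_1,\dots,\pi^*E_n$). That is, its arrows from $i$ to $j$ name elements of $\operatorname{Hom}_V(\pi^*E_j,\pi^*E_i)$,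 the composites of paths from $i$ to $j$ span this space, and the relations are all linear relations between them. Let $R=\operatorname{Spec}B$ be the affine scheme of representations of $\mathbf Q$ with the space $k$ at every node, on which $G=\mathbb G_m^n/\mathbb G_m^{\mathrm{diag}}$ acts by change of basis, and let $M_0=\operatorname{Spec}B^G$. The tautological map $T:V\to[R/G]$ sends a point $p$ to the representation of $\mathbf Q$ on the duals of the fibres of the $\pi^*E_i$ at $p$. Pulling back global functions along $T$ gives a well-defined morphism $\varphi_0:V_0\to M_0$. Then $\varphi_0$ is generically an isomorphism: there is a dense open subset $U\subseteq V_0$ such that $\varphi_0|_U$ is an isomorphism onto its image, and this image is open in $M_0$. -/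

import Mathlib

open CategoryTheory AlgebraicGeometry

universe u

noncomputable section

/-! ### Sheaves of modules on a scheme -/

/-- Multiplication by a global function `a`, as an endomorphism of an `𝒪_X`-module. -/
def globalSMul {X : Scheme.{u}} (M : X.Modules) (a : Γ(X, ⊤)) : M ⟶ M :=
  (Scheme.Modules.fullyFaithfulToPresheafOfModules (X := X)).preimage
    { app := fun U =>
        ModuleCat.ofHom (X := M.val.obj U) (Y := M.val.obj U)
          (LinearMap.lsmul Γ(X, U.unop) Γ(M, U.unop) (X.presheaf.map (homOfLE le_top).op a))
      naturality := by
        intro U W i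
        ext x
        have h := Scheme.Modules.map_smul M i.unop (X.presheaf.map (homOfLE le_top).op a) x
        have h2 : X.presheaf.map i.unop.op (X.presheaf.map (homOfLE le_top).op a) =
            X.presheaf.map (homOfLE (le_top : W.unop ≤ ⊤)).op a := by
          rw [← ConcreteCategory.comp_apply, ← Functor.map_comp]
          rfl
        rw [h2] at h
        exact h.symm }

theorem globalSMul_app {X : Scheme.{u}} (M : X.Modules) (a : Γ(X, ⊤)) (U : X.Opens)
    (x : Γ(M, U)) :
    (globalSMul M a).app U x =
      (X.presheaf.map (homOfLE (le_top : U ≤ ⊤)).op a : Γ(X, U)) • x := rfl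

/-- The scalars `k → Γ(X, U)` of a scheme over a ring `k`. -/
def scalar (k : Type u) [CommRing k] (X : Scheme.{u}) [X.Over (Spec (.of k))] (U : X.Opens) :
    k →+* Γ(X, U) :=
  ((Scheme.ΓSpecIso (.of k)).inv ≫ (X ↘ Spec (.of k)).appTop ≫
    X.presheaf.map (homOfLE le_top).op).hom

theorem globalSMul_one {X : Scheme.{u}} (M : X.Modules) : globalSMul M 1 = 𝟙 M := by
  ext U x
  simp [globalSMul_app]

theorem globalSMul_zero {X : Scheme.{u}} (M : X.Modules) : globalSMul M 0 = 0 := by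
  ext U x
  simp [globalSMul_app]

theorem globalSMul_add {X : Scheme.{u}} (M : X.Modules) (a b : Γ(X, ⊤)) :
    globalSMul M (a + b) = globalSMul M a + globalSMul M b := by
  ext U x
  simp [globalSMul_app, add_smul]

theorem globalSMul_mul {X : Scheme.{u}} (M : X.Modules) (a b : Γ(X, ⊤)) :
    globalSMul M (a * b) = globalSMul M b ≫ globalSMul M a := by
  ext U x
  simp only [Scheme.Modules.Hom.comp_app, ConcreteCategory.comp_apply, globalSMul_app, map_mul,
    mul_smul]

theorem globalSMul_comm {X : Scheme.{u}} {M N : X.Modules} (f : M ⟶ N) (a : Γ(X, ⊤)) :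
    globalSMul M a ≫ f = f ≫ globalSMul N a := by
  ext U x
  simp [globalSMul_app]

/-- The `𝒪_X`-modules on a scheme over `k` form a `k`-linear category, a scalar acting through
multiplication by the corresponding constant function. -/
instance modulesLinear (k : Type u) [CommRing k] (X : Scheme.{u}) [X.Over (Spec (.of k))] :
    Linear k X.Modules where
  homModule M N :=
    { smul := fun c f => f ≫ globalSMul N (scalar k X ⊤ c)
      one_smul := fun f => by
        change f ≫ globalSMul N (scalar k X ⊤ 1) = f
        rw [map_one, globalSMul_one, Category.comp_id]
      mul_smul := fun c d f => by
        change f ≫ globalSMul N (scalar k X ⊤ (c * d)) =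
          (f ≫ globalSMul N (scalar k X ⊤ d)) ≫ globalSMul N (scalar k X ⊤ c)
        rw [map_mul, globalSMul_mul, Category.assoc]
      smul_zero := fun c => by
        change (0 : M ⟶ N) ≫ globalSMul N (scalar k X ⊤ c) = 0
        rw [Limits.zero_comp]
      smul_add := fun c f g => by
        change (f + g) ≫ globalSMul N (scalar k X ⊤ c) =
          f ≫ globalSMul N (scalar k X ⊤ c) + g ≫ globalSMul N (scalar k X ⊤ c)
        rw [Preadditive.add_comp]
      add_smul := fun c d f => by
        change f ≫ globalSMul N (scalar k X ⊤ (c + d)) =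
          f ≫ globalSMul N (scalar k X ⊤ c) + f ≫ globalSMul N (scalar k X ⊤ d)
        rw [map_add, globalSMul_add, Preadditive.comp_add]
      zero_smul := fun f => by
        change f ≫ globalSMul N (scalar k X ⊤ 0) = 0
        rw [map_zero, globalSMul_zero, Limits.comp_zero] }
  smul_comp M N K c f g := by
    change (f ≫ globalSMul N (scalar k X ⊤ c)) ≫ g = (f ≫ g) ≫ globalSMul K (scalar k X ⊤ c)
    rw [Category.assoc, Category.assoc, globalSMul_comm]
  comp_smul M N K f c g := by
    change f ≫ g ≫ globalSMul K (scalar k X ⊤ c) = (f ≫ g) ≫ globalSMul K (scalar k X ⊤ c)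
    rw [Category.assoc]

/-- The structure sheaf as a module over itself. -/
abbrev structureModule (X : Scheme.{u}) : X.Modules := SheafOfModules.unit X.ringCatSheaf

/-- A line bundle: an `𝒪_X`-module that is locally isomorphic to `𝒪_X`. -/
def IsLineBundle {X : Scheme.{u}} (M : X.Modules) : Prop :=
  ∀ x : X, ∃ U : X.Opens, x ∈ U ∧ Nonempty (M.restrict U.ι ≅ structureModule U)

/-- The tensor product of `𝒪_X`-modules: the sheaf associated to `U ↦ M(U) ⊗ N(U)`. -/
def sheafTensor {X : Scheme.{u}} (M N : X.Modules) : X.Modules :=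
  (PresheafOfModules.sheafification (𝟙 X.ringCatSheaf.obj)).obj
    (PresheafOfModules.Monoidal.tensorObj (R := X.presheaf) M.val N.val)

/-- The tensor power `M^{⊗ r}`. -/
def sheafTensorPow {X : Scheme.{u}} (M : X.Modules) : ℕ → X.Modules
  | 0 => structureModule X
  | r + 1 => sheafTensor (sheafTensorPow M r) M

/-- Coherence, for modules on a locally noetherian scheme: local finite presentation. -/
def IsCoherentModule {X : Scheme.{u}} (M : X.Modules) : Prop :=
  SheafOfModules.IsFinitePresentation (R := X.ringCatSheaf) M

/-- `M` is generated by its global sections. -/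
def IsGloballyGenerated {X : Scheme.{u}} (M : X.Modules) : Prop :=
  Nonempty (SheafOfModules.GeneratingSections (R := X.ringCatSheaf) M)

/-- A line bundle `M` on a noetherian scheme is ample if for every coherent `F` the sheaves
`F ⊗ M^{⊗ r}` are globally generated for all large `r`. -/
def IsAmple {X : Scheme.{u}} (M : X.Modules) : Prop :=
  IsLineBundle M ∧ ∀ F : X.Modules, IsCoherentModule F →
    ∃ r₀ : ℕ, ∀ r ≥ r₀, IsGloballyGenerated (sheafTensor F (sheafTensorPow M r))

/-- The inverse line bundle `L⁻¹` is ample. -/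
def HasAmpleInverse {X : Scheme.{u}} (L : X.Modules) : Prop :=
  ∃ N : X.Modules, Nonempty (sheafTensor L N ≅ structureModule X) ∧ IsAmple N

attribute [local instance] MvPolynomial.gradedAlgebra in
/-- `X` is projective over `k`: it is a closed subscheme of some `ℙ^N_k`, over `k`. -/
def IsProjectiveOver (k : Type u) [CommRing k] (X : Scheme.{u}) [X.Over (Spec (.of k))] : Prop :=
  ∃ (N : ℕ) (i : X ⟶ Proj (MvPolynomial.homogeneousSubmodule (Fin (N + 1)) k)),
    IsClosedImmersion i ∧
      i ≫ Proj.toSpecZero (MvPolynomial.homogeneousSubmodule (Fin (N + 1)) k) ≫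
        Spec.map (CommRingCat.ofHom
          (algebraMap k (MvPolynomial.homogeneousSubmodule (Fin (N + 1)) k 0))) =
      X ↘ Spec (.of k)

/-! ### Exceptional collections and spirals -/

/-- `Ext^m(M, N) = 0`. -/
def ExtVanishes {C : Type*} [Category C] [Abelian C] (M N : C) (m : ℕ) : Prop :=
  letI := HasExt.standard C
  Subsingleton (Abelian.Ext M N m)

/-- The family `E` spans the derived category of coherent sheaves on `X`, realised as the
complexes of `𝒪_X`-modules with coherent cohomology: a complex that receives no nonzero morphism
from a shift of a member of `E` is zero. -/
def SpansDerivedCategory {X : Scheme.{u}} {ι : Type} (E : ι → X.Modules) : Prop :=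
  letI := HasDerivedCategory.standard X.Modules
  ∀ F : DerivedCategory X.Modules,
    (∀ m : ℤ, IsCoherentModule ((DerivedCategory.homologyFunctor X.Modules m).obj F)) →
    (∀ (i : ι) (m : ℤ) (f : (DerivedCategory.singleFunctor X.Modules m).obj (E i) ⟶ F), f = 0) →
    Limits.IsZero F

/-- A full, strong, exceptional collection of `𝒪_X`-modules on a scheme `X` over `k`. -/
structure IsFullStrongExceptional (k : Type u) [CommRing k] {X : Scheme.{u}}
    [X.Over (Spec (.of k))] {n : ℕ} (E : Fin n → X.Modules) : Prop where
  /-- `End(E_i) = k`. -/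
  end_eq : ∀ i, Function.Bijective (fun c : k => c • 𝟙 (E i))
  /-- `Hom(E_i, E_j) = 0` for `i > j`. -/
  hom_eq_zero : ∀ i j, j < i → ∀ f : E i ⟶ E j, f = 0
  /-- `Ext^m(E_i, E_j) = 0` for all `i`, `j` and all `m ≠ 0`. -/
  ext_eq_zero : ∀ i j, ∀ m : ℕ, m ≠ 0 → ExtVanishes (E i) (E j) m
  /-- The collection spans the derived category. -/
  full : SpansDerivedCategory E

/-- `E_1, …, E_n` generate a simple spiral with respect to `L`: they are a full, strong,
exceptional collection, `L⁻¹` is ample, and the extension of the collection to all integer indices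
by `E_{i - n} = E_i ⊗ L` satisfies `Ext^m(E_i, E_j) = 0` for `i ≤ j` and `m ≠ 0`. -/
structure GeneratesSimpleSpiral (k : Type u) [CommRing k] {X : Scheme.{u}}
    [X.Over (Spec (.of k))] {n : ℕ} (E : Fin n → X.Modules) (L : X.Modules) : Prop where
  exceptional : IsFullStrongExceptional k E
  ample : HasAmpleInverse L
  simple : ∃ F : ℤ → X.Modules,
    (∀ i : Fin n, Nonempty (F ((i : ℤ) + 1) ≅ E i)) ∧
    (∀ i : ℤ, Nonempty (F (i - n) ≅ sheafTensor (F i) L)) ∧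
    ∀ i j : ℤ, i ≤ j → ∀ m : ℕ, m ≠ 0 → ExtVanishes (F i) (F j) m

/-! ### The total space of a line bundle -/

/-- The pullback `f^*s` of a global section. -/
def pullbackSection {X Y : Scheme.{u}} (f : X ⟶ Y) {M : Y.Modules} (s : Γ(M, ⊤)) :
    Γ((Scheme.Modules.pullback f).obj M, ⊤) :=
  ((Scheme.Modules.pullbackPushforwardAdjunction f).unit.app M).app ⊤ s

/-- `π : V ⟶ X` with the section `s` of `π^*L` is the total space of `L`: giving a morphism
`T ⟶ V` over `f : T ⟶ X` is the same as giving a section of `f^*L`, through pulling back `s`. -/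
def IsTotalSpace {X V : Scheme.{u}} (L : X.Modules) (π : V ⟶ X)
    (s : Γ((Scheme.Modules.pullback π).obj L, ⊤)) : Prop :=
  ∀ (T : Scheme.{u}) (f : T ⟶ X) (t : Γ((Scheme.Modules.pullback f).obj L, ⊤)),
    ∃! g : T ⟶ V, ∃ h : g ≫ π = f,
      (((Scheme.Modules.pullbackComp g π) ≪≫ Scheme.Modules.pullbackCongr h).hom.app L).app ⊤
        (pullbackSection g s) = t

/-! ### Quivers with relations and their representations

A quiver with node set `ι` is given by its types of arrows `A i j`, from `i` to `j`. -/

/-- The paths of a quiver from `i` to `j`. -/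
inductive QPath {ι : Type} (A : ι → ι → Type u) (i : ι) : ι → Type u
  /-- The path of length zero. -/
  | nil : QPath A i i
  /-- A path followed by an arrow. -/
  | cons {j l : ι} (p : QPath A i j) (e : A j l) : QPath A i l

/-- If every arrow `i → j` names a morphism `E j ⟶ E i`, then so does every path, through
composition. (A morphism `E j ⟶ E i` acts on a left module over `End(⨁ E i)ᵒᵖ`, for instance on
`⨁ Hom(E i, M)`, by a map from the space at the node `i` to the space at the node `j`.) -/
def evalPath {ι : Type} {A : ι → ι → Type u} {C : Type*} [Category.{u} C] {E : ι → C}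
    (a : ∀ i j, A i j → (E j ⟶ E i)) {i : ι} : ∀ {j : ι}, QPath A i j → (E j ⟶ E i)
  | _, .nil => 𝟙 (E i)
  | _, .cons p e => a _ _ e ≫ evalPath a p

/-- A quiver with relations whose path algebra is the algebra `End(⨁ E i)ᵒᵖ`: a quiver, with a
morphism for each arrow, such that every morphism between the `E i` is a linear combination of
composites of paths. The ideal of relations is the kernel of the evaluation of paths. -/
structure QuiverPresentation (k : Type u) [CommRing k] {C : Type*} [Category.{u} C]
    [Preadditive C] [Linear k C] {ι : Type} (E : ι → C) where
  /-- The arrows from `i` to `j`. -/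
  Arrow : ι → ι → Type u
  /-- The morphism named by an arrow. -/
  toHom : ∀ i j, Arrow i j → (E j ⟶ E i)
  /-- Every morphism is a linear combination of composites of paths. -/
  surjective : ∀ i j, Function.Surjective
    (Finsupp.linearCombination k (fun p : QPath Arrow i j => evalPath toHom p))

namespace QuiverPresentation

variable {k : Type u} [CommRing k] {C : Type*} [Category.{u} C] [Preadditive C] [Linear k C]
  {ι : Type} {E : ι → C}

/-- The part of the ideal of relations from `i` to `j`: the linear combinations of paths that
vanish in `Hom(E j, E i)`. -/
def relations (Q : QuiverPresentation k E) (i j : ι) : Submodule k (QPath Q.Arrow i j →₀ k) :=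
  LinearMap.ker (Finsupp.linearCombination k (fun p => evalPath Q.toHom p))

/-- The coordinate ring of the space of representations of the quiver without relations on
one-dimensional spaces: one coordinate for each arrow. -/
abbrev FreeRing (Q : QuiverPresentation k E) : Type u :=
  MvPolynomial (Σ i j, Q.Arrow i j) k

/-- The action of a path in a representation on one-dimensional spaces: the product of the
coordinates of its arrows. -/
def pathMonomial (Q : QuiverPresentation k E) {i : ι} :
    ∀ {j : ι}, QPath Q.Arrow i j → Q.FreeRing
  | _, .nil => 1
  | _, .cons p e => MvPolynomial.X ⟨_, _, e⟩ * pathMonomial Q p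

/-- The ideal that says that the relations of the quiver hold. -/
def repIdeal (Q : QuiverPresentation k E) : Ideal Q.FreeRing :=
  Ideal.span {P | ∃ (i j : ι) (c : QPath Q.Arrow i j →₀ k), c ∈ Q.relations i j ∧
    P = Finsupp.linearCombination k (fun p => Q.pathMonomial p) c}

/-- The coordinate ring `B` of the affine scheme of representations of the quiver with relations
whose space at every node is `k`. -/
abbrev RepRing (Q : QuiverPresentation k E) : Type u := Q.FreeRing ⧸ Q.repIdeal

/-- The action of `g ∈ ∏ GL(1)` on the coordinates: a representation `x` is sent to the
representation `e ↦ g_j x_e g_i⁻¹` (for `e` from `i` to `j`), and `b` to `x ↦ b (g⁻¹ x)`. -/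
def freeAct (Q : QuiverPresentation k E) (g : ι → kˣ) : Q.FreeRing →ₐ[k] Q.FreeRing :=
  MvPolynomial.aeval fun e =>
    MvPolynomial.C (((g e.2.1)⁻¹ * g e.1 : kˣ) : k) * MvPolynomial.X e

theorem freeAct_pathMonomial (Q : QuiverPresentation k E) (g : ι → kˣ) {i j : ι}
    (p : QPath Q.Arrow i j) :
    Q.freeAct g (Q.pathMonomial p) = (((g j)⁻¹ * g i : kˣ) : k) • Q.pathMonomial p := by
  induction p with
  | nil => simp [pathMonomial]
  | @cons b c p e ih =>
    have h : ((g c)⁻¹ * g i : kˣ) = ((g c)⁻¹ * g b) * ((g b)⁻¹ * g i) := by group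
    rw [pathMonomial, map_mul, ih, h, freeAct, MvPolynomial.aeval_X, MvPolynomial.C_mul',
      smul_mul_smul_comm, Units.val_mul ((g c)⁻¹ * g b)]

/-- The action of `g ∈ ∏ GL(1)` on `B`. The diagonal acts trivially, so that this is an action of
the quotient `G` of `∏ GL(1)` by its diagonal. -/
def act (Q : QuiverPresentation k E) (g : ι → kˣ) : Q.RepRing →ₐ[k] Q.RepRing :=
  Ideal.quotientMapₐ Q.repIdeal (Q.freeAct g) <| by
    rw [repIdeal, Ideal.span_le]
    rintro _ ⟨i, j, c, hc, rfl⟩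
    have h : Q.freeAct g (Finsupp.linearCombination k (fun p => Q.pathMonomial p) c) =
        (((g j)⁻¹ * g i : kˣ) : k) •
          Finsupp.linearCombination k (fun p => Q.pathMonomial p) c := by
      simp only [Finsupp.linearCombination_apply, Finsupp.sum, map_sum, map_smul,
        freeAct_pathMonomial, Finset.smul_sum]
      exact Finset.sum_congr rfl fun p _ => smul_comm _ _ _
    change Q.freeAct g _ ∈ Q.repIdeal
    rw [h]
    exact Submodule.smul_of_tower_mem _ _ (Ideal.subset_span ⟨i, j, c, hc, rfl⟩)

/-- The ring of invariants `B^G`. -/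
def invariants (Q : QuiverPresentation k E) : Subalgebra k Q.RepRing :=
  ⨅ g : ι → kˣ, AlgHom.equalizer (Q.act g) (AlgHom.id k Q.RepRing)

/-- The affine quotient `M₀ = Spec B^G`. -/
def affineQuotient (Q : QuiverPresentation k E) : Scheme.{u} := Spec (.of Q.invariants)

/-- All morphisms between the `E i` as arrows. -/
def allMorphisms (k : Type u) [CommRing k] [Linear k C] (E : ι → C) : QuiverPresentation k E where
  Arrow i j := E j ⟶ E i
  toHom _ _ f := f
  surjective i j f := by
    refine ⟨Finsupp.single (.cons .nil f) 1, ?_⟩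
    rw [Finsupp.linearCombination_single, one_smul]
    exact Category.comp_id f

end QuiverPresentation

/-! ### The tautological map -/

/-- The section `m` of `M` over `U` is a frame: it makes `M` over `U` free of rank one. -/
def IsFrame {V : Scheme.{u}} {M : V.Modules} {U : V.Opens} (m : Γ(M, U)) : Prop :=
  ∀ (W : V.Opens) (h : W ≤ U),
    Function.Bijective fun r : Γ(V, W) => r • M.presheaf.map (homOfLE h).op m

/-- The ring homomorphism `T : B^G → Γ(V, 𝒪_V)` is the pullback of functions along the
tautological map, which sends a point of `V` to the representation on the duals of the fibres of the
line bundles `E i` there. Over an open `U` on which the `E i` have frames `m i`, this representation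
has in the dual frames the coordinates `r e ∈ Γ(V, U)` with `e (m j) = r e • m i`, for `e` from `i`
to `j` (that is, naming a morphism `E j ⟶ E i`), and `T` is the evaluation of polynomials at
these coordinates. -/
def IsTautologicalPullback {k : Type u} [CommRing k] {V : Scheme.{u}} [V.Over (Spec (.of k))]
    {ι : Type} {E : ι → V.Modules} (Q : QuiverPresentation k E)
    (T : Q.invariants →+* Γ(V, ⊤)) : Prop :=
  ∀ (U : V.Opens) (m : ∀ i, Γ(E i, U)), (∀ i, IsFrame (m i)) →
    ∀ r : (Σ i j, Q.Arrow i j) → Γ(V, U),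
      (∀ (i j : ι) (e : Q.Arrow i j), (Q.toHom i j e).app U (m j) = r ⟨i, j, e⟩ • m i) →
      ∀ (P : Q.FreeRing) (hP : Ideal.Quotient.mk Q.repIdeal P ∈ Q.invariants),
        V.presheaf.map (homOfLE le_top).op (T ⟨Ideal.Quotient.mk Q.repIdeal P, hP⟩) =
          MvPolynomial.eval₂Hom (scalar k V U) r P

/-- The affinization `V₀ = Spec Γ(V, 𝒪_V)`. -/
abbrev affinization (V : Scheme.{u}) : Scheme.{u} := Spec Γ(V, ⊤)

/-- `φ : V₀ ⟶ M₀` is the morphism obtained by pulling back functions along the tautological map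
from `V` to the stack of representations. -/
def IsTautologicalMap {k : Type u} [CommRing k] {V : Scheme.{u}} [V.Over (Spec (.of k))]
    {ι : Type} {E : ι → V.Modules} (Q : QuiverPresentation k E)
    (φ : affinization V ⟶ Q.affineQuotient) : Prop :=
  ∃ T : Q.invariants →+* Γ(V, ⊤), IsTautologicalPullback Q T ∧
    φ = Spec.map (CommRingCat.ofHom T)

end

/-! Write S for the ring of global functions of V and B^G for the ring of invariants. The theorem
comes down to the ring homomorphism T from B^G to S: it is surjective, and its kernel is killed by
an element c with T c ≠ 0. As S is a domain, inverting c then identifies the dense open set D(T c)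
of Spec S with the open set D(c) of Spec B^G.

The structure of B^G. A torus invariant is a combination of invariant monomials, by linear
independence of characters. Since k is infinite, a monomial is invariant only if each node occurs as
often as a source as it does as a target of its arrows. Such a monomial splits into closed loops,
and a loop acts through an endomorphism of one π^*E_i (`invariants_le_loopAlgebra`). On the integral
scheme V every endomorphism of a line bundle is multiplication by a global function
(`exists_eq_globalSMul`). So B^G is generated by n images of S, one for each node (`nodeFunction`),
and T is the identity on each of them. This gives existence, uniqueness and surjectivity of T.

The kernel of T. It measures the difference between the copies of S at different nodes. Given f :
π^*E_j ⟶ π^*E_i and g in the other direction, both nonzero, the composite g ≫ f is multiplication by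
some u ≠ 0. By centrality of functions, u at node i times s at node j equals u at node i times s at
node i (`nodeFunction_mul_eq`). The product of such u over all j is the function from which c is
made (`exists_mul_eq`).

Nonzero morphisms (`exists_pullback_hom_ne_zero`). Let N be the inverse of L and H the sheaf of
morphisms from M to M'. Pairing n in N with the tautological section s gives a function on V, so h ⊗
n^r ↦ ⟨s, n⟩^r π^*h maps H ⊗ N^r to the pushforward of the sheaf of morphisms from π^*M to π^*M'.
This map is not zero, and ampleness makes its source globally generated for large r, so its target
has a nonzero global section.

Integrality of V (`IsTotalSpace.isIntegral`). The universal property identifies V, over an open set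
where L has a frame, with the affine line over that set. These pieces are integral and meet
pairwise.

Line bundles are handled through frames. On an integral scheme, sections of a module with local
frames are determined on any nonempty open subset, so most identities are checked on one fixed
chart. -/

noncomputable section

/-! ### Sections of sheaves of modules -/

/-- Restriction of sections of an `𝒪_X`-module. -/
def secRes {X : Scheme.{u}} (M : X.Modules) {W U : X.Opens} (h : W ≤ U) : Γ(M, U) →+ Γ(M, W) :=
  (M.presheaf.map (homOfLE h).op).hom

/-- Restriction of functions. -/
def funRes (X : Scheme.{u}) {W U : X.Opens} (h : W ≤ U) : Γ(X, U) →+* Γ(X, W) :=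
  (X.presheaf.map (homOfLE h).op).hom

section

variable {X : Scheme.{u}} {M N : X.Modules}

theorem secRes_smul {W U : X.Opens} (h : W ≤ U) (r : Γ(X, U)) (x : Γ(M, U)) :
    secRes M h (r • x) = funRes X h r • secRes M h x :=
  Scheme.Modules.map_smul M (homOfLE h) r x

@[simp]
theorem secRes_secRes {W U T : X.Opens} (h : W ≤ U) (h' : U ≤ T) (x : Γ(M, T)) :
    secRes M h (secRes M h' x) = secRes M (h.trans h') x := by
  change (M.presheaf.map (homOfLE h').op ≫ M.presheaf.map (homOfLE h).op) x = _
  rw [← Functor.map_comp]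
  rfl

@[simp]
theorem secRes_rfl {U : X.Opens} (h : U ≤ U) (x : Γ(M, U)) : secRes M h x = x := by
  change M.presheaf.map (𝟙 _) x = x
  rw [CategoryTheory.Functor.map_id]
  rfl

@[simp]
theorem funRes_funRes {W U T : X.Opens} (h : W ≤ U) (h' : U ≤ T) (x : Γ(X, T)) :
    funRes X h (funRes X h' x) = funRes X (h.trans h') x := by
  change (X.presheaf.map (homOfLE h').op ≫ X.presheaf.map (homOfLE h).op) x = _
  rw [← Functor.map_comp]
  rfl

@[simp]
theorem funRes_rfl {U : X.Opens} (h : U ≤ U) (x : Γ(X, U)) : funRes X h x = x := by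
  change X.presheaf.map (𝟙 _) x = x
  rw [CategoryTheory.Functor.map_id]
  rfl

theorem hom_secRes (f : M ⟶ N) {W U : X.Opens} (h : W ≤ U) (x : Γ(M, U)) :
    f.app W (secRes M h x) = secRes N h (f.app U x) :=
  ConcreteCategory.congr_hom (f.mapPresheaf.naturality (homOfLE h).op) x

theorem modules_hom_ext {f g : M ⟶ N} (h : ∀ U (x : Γ(M, U)), f.app U x = g.app U x) : f = g := by
  ext U x
  exact h U x

/-- A morphism of `𝒪_X`-modules from its effect on sections. -/
def modulesHomMk (f : ∀ U : X.Opens, Γ(M, U) →+ Γ(N, U))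
    (hsmul : ∀ U (r : Γ(X, U)) (x : Γ(M, U)), f U (r • x) = r • f U x)
    (hres : ∀ (W U : X.Opens) (h : W ≤ U) (x : Γ(M, U)),
      f W (secRes M h x) = secRes N h (f U x)) : M ⟶ N :=
  (Scheme.Modules.fullyFaithfulToPresheafOfModules (X := X)).preimage
    { app := fun U => ModuleCat.ofHom (X := M.val.obj U) (Y := N.val.obj U)
        { toFun := f U.unop
          map_add' := (f U.unop).map_add
          map_smul' := hsmul U.unop }
      naturality := by
        intro U W i
        ext x
        exact hres W.unop U.unop i.unop.le x }

theorem sec_ext {U : X.Opens} {x y : Γ(M, U)}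
    (h : ∀ p ∈ U, ∃ (W : X.Opens) (hW : W ≤ U), p ∈ W ∧ secRes M hW x = secRes M hW y) :
    x = y := by
  choose! W hW hp he using h
  refine TopCat.Sheaf.eq_of_locally_eq' ⟨M.presheaf, M.isSheaf⟩ (fun p : U => W p) U
    (fun p => homOfLE (hW p p.2)) ?_ x y (fun p => he p p.2)
  intro p hp'
  exact TopologicalSpace.Opens.mem_iSup.mpr ⟨⟨p, hp'⟩, hp p hp'⟩

/-- Gluing of sections that are characterised by a local property. -/
theorem exists_glue {U : X.Opens} (P : ∀ W : X.Opens, Γ(M, W) → Prop)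
    (hres : ∀ (W T : X.Opens) (h : W ≤ T) (x : Γ(M, T)), P T x → P W (secRes M h x))
    (huniq : ∀ (W : X.Opens) (x y : Γ(M, W)), P W x → P W y → x = y)
    (hloc : ∀ p ∈ U, ∃ W : X.Opens, W ≤ U ∧ p ∈ W ∧ ∃ x : Γ(M, W), P W x) :
    ∃ x : Γ(M, U), ∀ p ∈ U, ∃ (W : X.Opens) (hW : W ≤ U), p ∈ W ∧ P W (secRes M hW x) := by
  choose! W hW hp x hx using hloc
  obtain ⟨s, hs, -⟩ := TopCat.Sheaf.existsUnique_gluing' ⟨M.presheaf, M.isSheaf⟩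
    (fun p : U => W p) U (fun p => homOfLE (hW p p.2))
    (fun p hp' => TopologicalSpace.Opens.mem_iSup.mpr ⟨⟨p, hp'⟩, hp p hp'⟩)
    (fun p => x p) (fun p q => huniq _ _ _ (hres _ _ inf_le_left _ (hx p p.2))
      (hres _ _ inf_le_right _ (hx q q.2)))
  refine ⟨s, fun p hp' => ⟨W p, hW p hp', hp p hp', ?_⟩⟩
  have := hs ⟨p, hp'⟩
  change secRes M _ s = x p at this
  rw [this]
  exact hx p hp'

/-- A function as a section of the structure sheaf. -/
def asSec {U : X.Opens} (r : Γ(X, U)) : Γ(structureModule X, U) := r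

/-- A section of the structure sheaf as a function. -/
def asFun {U : X.Opens} (x : Γ(structureModule X, U)) : Γ(X, U) := x

@[simp]
theorem asFun_asSec {U : X.Opens} (r : Γ(X, U)) : asFun (asSec r) = r := rfl

@[simp]
theorem asSec_asFun {U : X.Opens} (x : Γ(structureModule X, U)) : asSec (asFun x) = x := rfl

theorem smul_asSec {U : X.Opens} (r x : Γ(X, U)) : r • asSec x = asSec (r * x) := rfl

@[simp]
theorem asFun_smul {U : X.Opens} (r : Γ(X, U)) (x : Γ(structureModule X, U)) :
    asFun (r • x) = r * asFun x := rfl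

@[simp]
theorem asFun_add {U : X.Opens} (x y : Γ(structureModule X, U)) :
    asFun (x + y) = asFun x + asFun y := rfl

@[simp]
theorem secRes_asSec {W U : X.Opens} (h : W ≤ U) (r : Γ(X, U)) :
    secRes (structureModule X) h (asSec r) = asSec (funRes X h r) := rfl

@[simp]
theorem asFun_secRes {W U : X.Opens} (h : W ≤ U) (x : Γ(structureModule X, U)) :
    asFun (secRes (structureModule X) h x) = funRes X h (asFun x) := rfl

theorem fun_ext {U : X.Opens} {x y : Γ(X, U)}
    (h : ∀ p ∈ U, ∃ (W : X.Opens) (hW : W ≤ U), p ∈ W ∧ funRes X hW x = funRes X hW y) :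
    x = y :=
  sec_ext (M := structureModule X) h

theorem exists_glue_fun {U : X.Opens} (P : ∀ W : X.Opens, Γ(X, W) → Prop)
    (hres : ∀ (W T : X.Opens) (h : W ≤ T) (x : Γ(X, T)), P T x → P W (funRes X h x))
    (huniq : ∀ (W : X.Opens) (x y : Γ(X, W)), P W x → P W y → x = y)
    (hloc : ∀ p ∈ U, ∃ W : X.Opens, W ≤ U ∧ p ∈ W ∧ ∃ x : Γ(X, W), P W x) :
    ∃ x : Γ(X, U), ∀ p ∈ U, ∃ (W : X.Opens) (hW : W ≤ U), p ∈ W ∧ P W (funRes X hW x) :=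
  exists_glue (M := structureModule X) P hres huniq hloc

/-! ### Frames -/

theorem isFrame_iff {U : X.Opens} {m : Γ(M, U)} :
    IsFrame m ↔ ∀ (W : X.Opens) (h : W ≤ U),
      Function.Bijective fun r : Γ(X, W) => r • secRes M h m := Iff.rfl

theorem IsFrame.restrict {U W : X.Opens} {m : Γ(M, U)} (hm : IsFrame m) (h : W ≤ U) :
    IsFrame (secRes M h m) := by
  intro T hT
  have := hm T (hT.trans h)
  change Function.Bijective fun r : Γ(X, T) => r • secRes M hT (secRes M h m)
  rw [secRes_secRes]
  exact this

theorem IsFrame.bijective {U : X.Opens} {m : Γ(M, U)} (hm : IsFrame m) :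
    Function.Bijective fun r : Γ(X, U) => r • m := by
  have := hm U le_rfl
  change Function.Bijective fun r : Γ(X, U) => r • secRes M le_rfl m at this
  rwa [secRes_rfl] at this

theorem IsFrame.exists_eq {U : X.Opens} {m : Γ(M, U)} (hm : IsFrame m) (x : Γ(M, U)) :
    ∃ r : Γ(X, U), x = r • m := by
  obtain ⟨r, hr⟩ := hm.bijective.2 x
  exact ⟨r, hr.symm⟩

theorem IsFrame.smul_inj {U : X.Opens} {m : Γ(M, U)} (hm : IsFrame m) {r r' : Γ(X, U)}
    (h : r • m = r' • m) : r = r' := hm.bijective.1 h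

/-- The coordinate of a section in a frame. -/
def IsFrame.coord {U : X.Opens} {m : Γ(M, U)} (hm : IsFrame m) (x : Γ(M, U)) : Γ(X, U) :=
  (hm.exists_eq x).choose

theorem IsFrame.coord_smul {U : X.Opens} {m : Γ(M, U)} (hm : IsFrame m) (x : Γ(M, U)) :
    hm.coord x • m = x := ((hm.exists_eq x).choose_spec).symm

theorem IsFrame.coord_eq {U : X.Opens} {m : Γ(M, U)} (hm : IsFrame m) {x : Γ(M, U)}
    {r : Γ(X, U)} (h : x = r • m) : hm.coord x = r :=
  hm.smul_inj ((hm.coord_smul x).trans h)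

theorem IsFrame.coord_add {U : X.Opens} {m : Γ(M, U)} (hm : IsFrame m) (x y : Γ(M, U)) :
    hm.coord (x + y) = hm.coord x + hm.coord y :=
  hm.coord_eq (by rw [add_smul, hm.coord_smul, hm.coord_smul])

theorem IsFrame.coord_smul_left {U : X.Opens} {m : Γ(M, U)} (hm : IsFrame m) (r : Γ(X, U))
    (x : Γ(M, U)) : hm.coord (r • x) = r * hm.coord x :=
  hm.coord_eq (by rw [mul_smul, hm.coord_smul])

/-- Local frames everywhere. -/
def HasFrames (M : X.Modules) : Prop :=
  ∀ p : X, ∃ (U : X.Opens) (m : Γ(M, U)), p ∈ U ∧ IsFrame m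

theorem isFrame_one (U : X.Opens) : IsFrame (asSec (1 : Γ(X, U))) := by
  intro W h
  change Function.Bijective fun r : Γ(X, W) => r • secRes (structureModule X) h (asSec 1)
  simp only [secRes_asSec, map_one, smul_asSec, mul_one]
  exact Function.bijective_id

theorem IsFrame.map_iso {U : X.Opens} {m : Γ(M, U)} (hm : IsFrame m) (e : M ≅ N) :
    IsFrame (e.hom.app U m) := by
  rw [isFrame_iff]
  intro W h
  have key : ∀ r : Γ(X, W), r • secRes N h (e.hom.app U m) =
      e.hom.app W (r • secRes M h m) := fun r => by
    rw [Scheme.Modules.Hom.app_smul, hom_secRes]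
  simp only [key]
  have hb : Function.Bijective (e.hom.app W) :=
    ConcreteCategory.bijective_of_isIso (e.hom.app W)
  exact hb.comp (hm W h)

theorem restrict_smul {U : X.Opens} {W : U.toScheme.Opens} (r : Γ(U.toScheme, W))
    (x : Γ(M.restrict U.ι, W)) :
    r • x = (show Γ(M, U.ι ''ᵁ W) from
      (U.ι.appIso W).inv r • (show Γ(M, U.ι ''ᵁ W) from x)) := rfl

/-- Every open subset of `U` is the image of its preimage in the scheme `U`, and the two scalar
actions differ by the bijection `appIso`. -/
theorem IsFrame.of_restrict {U : X.Opens} {m : Γ(M.restrict U.ι, ⊤)} (hm : IsFrame m) :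
    IsFrame (M := M) (U := U.ι ''ᵁ ⊤) (show Γ(M, U.ι ''ᵁ ⊤) from m) := by
  rw [isFrame_iff]
  intro W h
  have hWU : W ≤ U := by simpa using h
  obtain ⟨W, rfl⟩ : ∃ W' : U.toScheme.Opens, W = U.ι ''ᵁ W' :=
    ⟨U.ι ⁻¹ᵁ W, by simp [Scheme.Hom.image_preimage_eq_opensRange_inf, hWU]⟩
  have hb := isFrame_iff.mp hm W le_top
  have key : (fun r : Γ(U.toScheme, W) => r • secRes (M.restrict U.ι) le_top m) =
      fun r => (U.ι.appIso W).inv r • secRes M h (show Γ(M, U.ι ''ᵁ ⊤) from m) := by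
    funext r
    rw [restrict_smul]
    rfl
  rw [key] at hb
  have hb2 : Function.Bijective (U.ι.appIso W).inv :=
    ConcreteCategory.bijective_of_isIso (U.ι.appIso W).inv
  exact (Function.Bijective.of_comp_iff (fun r => r • secRes M h _) hb2).mp hb

theorem IsLineBundle.hasFrames (hM : IsLineBundle M) : HasFrames M := by
  intro p
  obtain ⟨U, hp, ⟨e⟩⟩ := hM p
  refine ⟨U.ι ''ᵁ ⊤, _, ?_, IsFrame.of_restrict ((isFrame_one ⊤).map_iso e.symm)⟩
  simpa using hp

theorem HasFrames.exists_le (hM : HasFrames M) {p : X} {U : X.Opens} (hp : p ∈ U) :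
    ∃ (W : X.Opens) (m : Γ(M, W)), p ∈ W ∧ W ≤ U ∧ IsFrame m := by
  obtain ⟨W, m, hpW, hm⟩ := hM p
  exact ⟨W ⊓ U, secRes M inf_le_left m, ⟨hpW, hp⟩, inf_le_right, hm.restrict _⟩

theorem exists_common_frames {n : ℕ} {E : Fin n → X.Modules} (hE : ∀ i, HasFrames (E i)) {p : X}
    {U : X.Opens} (hp : p ∈ U) :
    ∃ (W : X.Opens) (m : ∀ i, Γ(E i, W)), p ∈ W ∧ W ≤ U ∧ ∀ i, IsFrame (m i) := by
  choose T m hpT hTU hm using fun i => (hE i).exists_le hp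
  refine ⟨U ⊓ Finset.univ.inf T, fun i => secRes (E i)
    (inf_le_right.trans (Finset.inf_le (Finset.mem_univ i))) (m i), ⟨hp, ?_⟩, inf_le_left,
    fun i => (hm i).restrict _⟩
  have key : ∀ s : Finset (Fin n), p ∈ s.inf T := by
    intro s
    induction s using Finset.induction_on with
    | empty => simp
    | insert a s _ ih => rw [Finset.inf_insert]; exact ⟨hpT a, ih⟩
  exact key _

/-! ### Integral schemes -/

theorem funRes_injective [IsIntegral X] {W U : X.Opens} (h : W ≤ U) (hW : (W : Set X).Nonempty) :
    Function.Injective (funRes X h) := by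
  have : Nonempty W := ⟨⟨_, hW.some_mem⟩⟩
  exact map_injective_of_isIntegral X (homOfLE h)

theorem inter_nonempty [IsIntegral X] {U W : X.Opens} (hU : (U : Set X).Nonempty)
    (hW : (W : Set X).Nonempty) : ((U ⊓ W : X.Opens) : Set X).Nonempty :=
  nonempty_preirreducible_inter U.2 W.2 hU hW

theorem isDomain_sections [IsIntegral X] {U : X.Opens} (hU : (U : Set X).Nonempty) :
    IsDomain Γ(X, U) := by
  have : Nonempty U := ⟨⟨_, hU.some_mem⟩⟩
  infer_instance

/-- Restriction to smaller nonempty open subsets is injective. -/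
def TorsionFree (M : X.Modules) : Prop :=
  ∀ (W U : X.Opens) (h : W ≤ U), (W : Set X).Nonempty → Function.Injective (secRes M h)

/-- In a frame the statement is about functions, whose restriction to a nonempty open subset of an
integral scheme is injective. -/
theorem HasFrames.torsionFree [IsIntegral X] (hM : HasFrames M) : TorsionFree M := by
  intro W U h hW
  refine (injective_iff_map_eq_zero _).mpr fun x hx => sec_ext fun p hp => ?_
  obtain ⟨T, m, hpT, hTU, hm⟩ := hM.exists_le hp
  refine ⟨T, hTU, hpT, ?_⟩
  obtain ⟨r, hr⟩ := hm.exists_eq (secRes M hTU x)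
  have hTW := inter_nonempty ⟨p, hpT⟩ hW
  have h0 : funRes X (inf_le_left : T ⊓ W ≤ T) r • secRes M inf_le_left m =
      (0 : Γ(X, T ⊓ W)) • secRes M (inf_le_left : T ⊓ W ≤ T) m := by
    rw [← secRes_smul, ← hr, zero_smul, secRes_secRes,
      ← secRes_secRes (inf_le_right : T ⊓ W ≤ W) h, hx, map_zero]
  have h1 := (hm.restrict (inf_le_left : T ⊓ W ≤ T)).smul_inj h0
  rw [← map_zero (funRes X (inf_le_left : T ⊓ W ≤ T))] at h1
  rw [hr, funRes_injective _ hTW h1, zero_smul, map_zero]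

theorem smul_eq_zero_of_hasFrames [IsIntegral X] (hM : HasFrames M) {U : X.Opens} {r : Γ(X, U)}
    {x : Γ(M, U)} (h : r • x = 0) : r = 0 ∨ x = 0 := by
  rcases Set.eq_empty_or_nonempty (U : Set X) with hU | ⟨p, hp⟩
  · right
    refine sec_ext fun p hp => ?_
    exact absurd (show p ∈ (U : Set X) from hp) (by simp [hU])
  obtain ⟨T, m, hpT, hTU, hm⟩ := hM.exists_le hp
  obtain ⟨a, ha⟩ := hm.exists_eq (secRes M hTU x)
  have := isDomain_sections (X := X) (U := T) ⟨p, hpT⟩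
  have h0 : (funRes X hTU r * a) • m = (0 : Γ(X, T)) • m := by
    rw [mul_smul, ← ha, ← secRes_smul, h, map_zero, zero_smul]
  rcases mul_eq_zero.mp (hm.smul_inj h0) with h1 | h1
  · left
    exact funRes_injective hTU ⟨p, hpT⟩ (by rw [h1, map_zero])
  · right
    exact hM.torsionFree _ _ hTU ⟨p, hpT⟩ (by rw [ha, h1, zero_smul, map_zero])

end

/-! ### Pulling back local sections -/

section

variable {X Y Z : Scheme.{u}}

/-- The pullback of a local section. -/
def pullbackLocal (f : X ⟶ Y) {M : Y.Modules} {U : Y.Opens} (x : Γ(M, U)) :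
    Γ((Scheme.Modules.pullback f).obj M, f ⁻¹ᵁ U) :=
  ((Scheme.Modules.pullbackPushforwardAdjunction f).unit.app M).app U x

variable (f : X ⟶ Y) {M N : Y.Modules}

theorem pullbackLocal_add {U : Y.Opens} (x y : Γ(M, U)) :
    pullbackLocal f (x + y) = pullbackLocal f x + pullbackLocal f y :=
  map_add (((Scheme.Modules.pullbackPushforwardAdjunction f).unit.app M).app U).hom x y

theorem pullbackLocal_smul {U : Y.Opens} (r : Γ(Y, U)) (x : Γ(M, U)) :
    pullbackLocal f (r • x) = f.app U r • pullbackLocal f x :=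
  Scheme.Modules.Hom.app_smul ((Scheme.Modules.pullbackPushforwardAdjunction f).unit.app M) r x

theorem secRes_pullbackLocal {W U : Y.Opens} (h : W ≤ U) (h' : f ⁻¹ᵁ W ≤ f ⁻¹ᵁ U) (x : Γ(M, U)) :
    secRes _ h' (pullbackLocal f x) = pullbackLocal f (secRes M h x) :=
  (hom_secRes ((Scheme.Modules.pullbackPushforwardAdjunction f).unit.app M) h x).symm

theorem funRes_app {W U : Y.Opens} (h : W ≤ U) (h' : f ⁻¹ᵁ W ≤ f ⁻¹ᵁ U) (r : Γ(Y, U)) :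
    funRes X h' (f.app U r) = f.app W (funRes Y h r) :=
  (ConcreteCategory.congr_hom (f.naturality (homOfLE h).op) r).symm

/-- Morphisms out of a pullback are determined by pulled back sections. -/
theorem pullback_hom_ext {P : X.Modules} {φ ψ : (Scheme.Modules.pullback f).obj M ⟶ P}
    (h : ∀ (U : Y.Opens) (x : Γ(M, U)),
      φ.app _ (pullbackLocal f x) = ψ.app _ (pullbackLocal f x)) : φ = ψ := by
  refine ((Scheme.Modules.pullbackPushforwardAdjunction f).homEquiv _ _).injective ?_
  rw [Adjunction.homEquiv_unit, Adjunction.homEquiv_unit]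
  exact modules_hom_ext h

/-- The morphism out of a pullback with prescribed values on pulled back sections. -/
theorem exists_pullback_hom {P : X.Modules} (φ : M ⟶ (Scheme.Modules.pushforward f).obj P) :
    ∃ ψ : (Scheme.Modules.pullback f).obj M ⟶ P, ∀ (U : Y.Opens) (x : Γ(M, U)),
      ψ.app _ (pullbackLocal f x) = φ.app U x := by
  refine ⟨((Scheme.Modules.pullbackPushforwardAdjunction f).homEquiv _ _).symm φ, fun U x => ?_⟩
  have := ((Scheme.Modules.pullbackPushforwardAdjunction f).homEquiv _ _).apply_symm_apply φ
  rw [Adjunction.homEquiv_unit] at this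
  exact ConcreteCategory.congr_hom (congrArg (fun ψ => Scheme.Modules.Hom.app ψ U) this) x

theorem pullbackComp_pullbackLocal (g : Z ⟶ X) {U : Y.Opens} (x : Γ(M, U)) :
    ((Scheme.Modules.pullbackComp g f).hom.app M).app (g ⁻¹ᵁ f ⁻¹ᵁ U)
      (pullbackLocal g (pullbackLocal f x)) = pullbackLocal (g ≫ f) x := by
  -- `pullbackComp` is characterised through the mate of its inverse. Comparing the units of the two
  -- adjunctions turns this into a formula for pulled back sections, from which the inverse is then
  -- cancelled.
  have h := Scheme.Modules.conjugateEquiv_pullbackComp_inv g f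
  have h2 := unit_conjugateEquiv
    ((Scheme.Modules.pullbackPushforwardAdjunction f).comp
      (Scheme.Modules.pullbackPushforwardAdjunction g))
    (Scheme.Modules.pullbackPushforwardAdjunction (g ≫ f)) (Scheme.Modules.pullbackComp g f).inv M
  rw [h] at h2
  have h3 := ConcreteCategory.congr_hom (congrArg (fun ψ => Scheme.Modules.Hom.app ψ U) h2) x
  have h4 : pullbackLocal g (pullbackLocal f x) =
      ((Scheme.Modules.pullbackComp g f).inv.app M).app (g ⁻¹ᵁ f ⁻¹ᵁ U)
        (pullbackLocal (g ≫ f) x) := h3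
  rw [h4]
  have h5 := (Scheme.Modules.pullbackComp g f).inv_hom_id_app M
  exact ConcreteCategory.congr_hom
    (congrArg (fun ψ => Scheme.Modules.Hom.app ψ (g ⁻¹ᵁ f ⁻¹ᵁ U)) h5) _

/-! ### Restriction to an open subset -/

/-- The part of `W` in `U`, as an open subset of the whole space. -/
abbrev openPart (U : X.Opens) (W : X.Opens) : X.Opens := U.ι ''ᵁ U.ι ⁻¹ᵁ W

theorem openPart_le_left (U W : X.Opens) : openPart U W ≤ U := by
  simp [Scheme.Hom.image_preimage_eq_opensRange_inf]

theorem openPart_le_right (U W : X.Opens) : openPart U W ≤ W := by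
  simp [Scheme.Hom.image_preimage_eq_opensRange_inf]

theorem le_openPart {U W T : X.Opens} (h : T ≤ U) (h' : T ≤ W) : T ≤ openPart U W := by
  simp [Scheme.Hom.image_preimage_eq_opensRange_inf, h, h']

theorem openPart_mono (U : X.Opens) {W T : X.Opens} (h : W ≤ T) : openPart U W ≤ openPart U T :=
  le_openPart (openPart_le_left _ _) ((openPart_le_right _ _).trans h)

/-- The `𝒪_X`-module `W ↦ M(U ∩ W)`. -/
def openExtension (M : X.Modules) (U : X.Opens) : X.Modules :=
  (Scheme.Modules.pushforward U.ι).obj (M.restrict U.ι)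

/-- A section of `M` over `U ∩ W` as a section of `openExtension M U` over `W`. -/
def toExtend {M : X.Modules} {U W : X.Opens} (x : Γ(M, openPart U W)) :
    Γ(openExtension M U, W) := x

/-- A section of `openExtension M U` over `W` as a section of `M` over `U ∩ W`. -/
def ofExtend {M : X.Modules} {U W : X.Opens} (x : Γ(openExtension M U, W)) :
    Γ(M, openPart U W) := x

@[simp]
theorem ofExtend_toExtend {M : X.Modules} {U W : X.Opens} (x : Γ(M, openPart U W)) :
    ofExtend (toExtend x) = x := rfl

@[simp]
theorem ofExtend_add {M : X.Modules} {U W : X.Opens} (x y : Γ(openExtension M U, W)) :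
    ofExtend (x + y) = ofExtend x + ofExtend y := rfl

@[simp]
theorem ofExtend_zero {M : X.Modules} {U W : X.Opens} :
    ofExtend (0 : Γ(openExtension M U, W)) = 0 := rfl

theorem ofExtend_smul {M : X.Modules} {U W : X.Opens} (r : Γ(X, W)) (x : Γ(openExtension M U, W)) :
    ofExtend (r • x) = funRes X (openPart_le_right U W) r • ofExtend x := by
  change (U.ι.appIso (U.ι ⁻¹ᵁ W)).inv (U.ι.app W r) • ofExtend x = _
  congr 1
  have := Scheme.Hom.app_appIso_inv U.ι W
  exact ConcreteCategory.congr_hom this r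

theorem secRes_ofExtend {M : X.Modules} {U W T : X.Opens} (h : W ≤ T) (x : Γ(openExtension M U, T)) :
    ofExtend (secRes _ h x) = secRes M (openPart_mono U h) (ofExtend x) := rfl

theorem ofExtend_injective {M : X.Modules} {U W : X.Opens} {x y : Γ(openExtension M U, W)}
    (h : ofExtend x = ofExtend y) : x = y := h

/-- A morphism to `openExtension M U`. -/
def homToExtension {M P : X.Modules} (U : X.Opens) (g : ∀ W : X.Opens, Γ(M, W) → Γ(P, openPart U W))
    (hadd : ∀ W (x y : Γ(M, W)), g W (x + y) = g W x + g W y)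
    (hsmul : ∀ W (r : Γ(X, W)) (x : Γ(M, W)), g W (r • x) =
      funRes X (openPart_le_right U W) r • g W x)
    (hres : ∀ (W T : X.Opens) (h : W ≤ T) (x : Γ(M, T)),
      g W (secRes M h x) = secRes P (openPart_mono U h) (g T x)) : M ⟶ openExtension P U :=
  modulesHomMk (fun W => AddMonoidHom.mk' (fun x => toExtend (g W x)) (fun x y => hadd W x y))
    (fun W r x => (hsmul W r x).trans (ofExtend_smul r (toExtend (g W x))).symm)
    (fun W T h x => hres W T h x)

/-- A morphism to a pushforward. -/
def homToPushforward {M : Y.Modules} {P : X.Modules}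
    (g : ∀ W : Y.Opens, Γ(M, W) → Γ(P, f ⁻¹ᵁ W))
    (hadd : ∀ W (x y : Γ(M, W)), g W (x + y) = g W x + g W y)
    (hsmul : ∀ W (r : Γ(Y, W)) (x : Γ(M, W)), g W (r • x) = f.app W r • g W x)
    (hres : ∀ (W T : Y.Opens) (h : W ≤ T) (x : Γ(M, T)),
      g W (secRes M h x) = secRes P (f.preimage_mono h) (g T x)) :
    M ⟶ (Scheme.Modules.pushforward f).obj P :=
  modulesHomMk (N := (Scheme.Modules.pushforward f).obj P)
    (fun W => AddMonoidHom.mk' (g W) (hadd W)) hsmul hres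

/-- Restriction of sections, as a morphism. -/
def toOpenExtension (M : X.Modules) (U : X.Opens) : M ⟶ openExtension M U :=
  homToExtension U (fun W => secRes M (openPart_le_right U W)) (fun _ _ _ => map_add _ _ _)
    (fun _ _ _ => secRes_smul _ _ _)
    (fun _ _ _ _ => by rw [secRes_secRes, secRes_secRes])

theorem ofExtend_toOpenExtension (M : X.Modules) (U W : X.Opens) (x : Γ(M, W)) :
    ofExtend ((toOpenExtension M U).app W x) = secRes M (openPart_le_right U W) x := rfl

/-- The coordinate, on the part of `W` in `U`, in a frame over `U`. -/
def localCoord {M : X.Modules} {U : X.Opens} {m : Γ(M, U)} (hm : IsFrame m) {W : X.Opens}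
    (x : Γ(M, W)) : Γ(X, openPart U W) :=
  (hm.restrict (openPart_le_left U W)).coord (secRes M (openPart_le_right U W) x)

theorem localCoord_smul {M : X.Modules} {U : X.Opens} {m : Γ(M, U)} (hm : IsFrame m)
    {W : X.Opens} (x : Γ(M, W)) :
    localCoord hm x • secRes M (openPart_le_left U W) m = secRes M (openPart_le_right U W) x :=
  (hm.restrict (openPart_le_left U W)).coord_smul _

theorem localCoord_add {M : X.Modules} {U : X.Opens} {m : Γ(M, U)} (hm : IsFrame m)
    {W : X.Opens} (x y : Γ(M, W)) : localCoord hm (x + y) = localCoord hm x + localCoord hm y := by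
  rw [localCoord, map_add, IsFrame.coord_add]
  rfl

theorem localCoord_smul_left {M : X.Modules} {U : X.Opens} {m : Γ(M, U)} (hm : IsFrame m)
    {W : X.Opens} (r : Γ(X, W)) (x : Γ(M, W)) :
    localCoord hm (r • x) = funRes X (openPart_le_right U W) r * localCoord hm x := by
  rw [localCoord, secRes_smul, IsFrame.coord_smul_left]
  rfl

theorem localCoord_secRes {M : X.Modules} {U : X.Opens} {m : Γ(M, U)} (hm : IsFrame m)
    {W T : X.Opens} (h : W ≤ T) (x : Γ(M, T)) :
    localCoord hm (secRes M h x) = funRes X (openPart_mono U h) (localCoord hm x) := by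
  refine IsFrame.coord_eq _ ?_
  rw [← secRes_secRes (openPart_mono U h) (openPart_le_left U T), ← secRes_smul, localCoord_smul,
    secRes_secRes, secRes_secRes]

/-! ### Frames of a pullback. -/

theorem preimage_le_openPart (U W : Y.Opens) :
    openPart (f ⁻¹ᵁ U) (f ⁻¹ᵁ W) ≤ f ⁻¹ᵁ (openPart U W) := by
  have h : f ⁻¹ᵁ (U ⊓ W) ≤ f ⁻¹ᵁ (openPart U W) :=
    f.preimage_mono (le_openPart inf_le_left inf_le_right)
  exact (le_inf (openPart_le_left (f ⁻¹ᵁ U) (f ⁻¹ᵁ W)) (openPart_le_right _ _)).trans h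

/-- The coordinate of `f^*x` in `f^*m`, where `m` is a frame. -/
def pullbackCoord {M : Y.Modules} {U : Y.Opens} {m : Γ(M, U)} (hm : IsFrame m) {W : Y.Opens}
    (x : Γ(M, W)) : Γ(X, openPart (f ⁻¹ᵁ U) (f ⁻¹ᵁ W)) :=
  funRes X (preimage_le_openPart f U W) (f.app _ (localCoord hm x))

theorem pullbackCoord_smul {M : Y.Modules} {U : Y.Opens} {m : Γ(M, U)} (hm : IsFrame m)
    {W : Y.Opens} (x : Γ(M, W)) :
    pullbackCoord f hm x • secRes _ (openPart_le_left (f ⁻¹ᵁ U) (f ⁻¹ᵁ W)) (pullbackLocal f m) =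
      secRes _ (openPart_le_right (f ⁻¹ᵁ U) (f ⁻¹ᵁ W)) (pullbackLocal f x) := by
  rw [← secRes_secRes (preimage_le_openPart f U W) (f.preimage_mono (openPart_le_left U W)),
    ← secRes_secRes (preimage_le_openPart f U W) (f.preimage_mono (openPart_le_right U W)),
    pullbackCoord, ← secRes_smul, secRes_pullbackLocal, secRes_pullbackLocal,
    ← pullbackLocal_smul, localCoord_smul]
  exact openPart_le_left U W

/-- The coordinates in `f^*m`, where `m` is a frame over `U`, as a morphism. -/
def pullbackCoordHom {M : Y.Modules} {U : Y.Opens} {m : Γ(M, U)} (hm : IsFrame m) :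
    M ⟶ (Scheme.Modules.pushforward f).obj (openExtension (structureModule X) (f ⁻¹ᵁ U)) :=
  homToPushforward f (fun W x => toExtend (asSec (pullbackCoord f hm x)))
    (fun W x y => ofExtend_injective (congrArg asSec (by
      rw [pullbackCoord, localCoord_add, map_add, map_add]
      rfl)))
    (fun W r x => ofExtend_injective (by
      rw [ofExtend_smul, ofExtend_toExtend, ofExtend_toExtend, smul_asSec]
      refine congrArg asSec ?_
      rw [pullbackCoord, localCoord_smul_left, map_mul, map_mul,
        ← funRes_app f (openPart_le_right U W) (f.preimage_mono (openPart_le_right U W)),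
        funRes_funRes]
      rfl))
    (fun W T h x => ofExtend_injective (by
      rw [secRes_ofExtend, ofExtend_toExtend, ofExtend_toExtend, secRes_asSec]
      refine congrArg asSec ?_
      rw [pullbackCoord, localCoord_secRes,
        ← funRes_app f (openPart_mono U h) (f.preimage_mono (openPart_mono U h)), pullbackCoord,
        funRes_funRes, funRes_funRes]))

/-- Multiplication of a section by functions, over an open subset. -/
def smulSection {P : X.Modules} {U : X.Opens} (m : Γ(P, U)) :
    openExtension (structureModule X) U ⟶ openExtension P U :=
  homToExtension U (fun W r => asFun (ofExtend r) • secRes P (openPart_le_left U W) m)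
    (fun W x y => by rw [ofExtend_add, asFun_add, add_smul])
    (fun W r x => by rw [ofExtend_smul, asFun_smul, mul_smul])
    (fun W T h x => by rw [secRes_smul, secRes_secRes, secRes_ofExtend, asFun_secRes])

/-- Sections of a pullback are accessible only through morphisms out of it. The coordinate in `m` is
adjoint to a morphism `c` from the pullback to functions on the preimage of `U`. Multiplication by
the pullback of `m` is a left and right inverse of `c` over that preimage, because both composites
can be tested on pulled back sections and on the frame. -/
theorem IsFrame.pullbackLocal {M : Y.Modules} {U : Y.Opens} {m : Γ(M, U)} (hm : IsFrame m) :
    IsFrame (pullbackLocal f m) := by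
  obtain ⟨c, hc⟩ := exists_pullback_hom f (pullbackCoordHom f hm)
  have hc' : ∀ (W : Y.Opens) (x : Γ(M, W)), asFun (ofExtend (c.app (f ⁻¹ᵁ W)
      (_root_.pullbackLocal f x))) = pullbackCoord f hm x := fun W x => by rw [hc]; rfl
  have key : c ≫ smulSection (_root_.pullbackLocal f m) = toOpenExtension _ _ := by
    refine pullback_hom_ext f fun W x => ofExtend_injective ?_
    rw [ofExtend_toOpenExtension, ← pullbackCoord_smul f hm, ← hc']
    rfl
  have key2 : ∀ (W : X.Opens) (y : Γ((Scheme.Modules.pullback f).obj M, W)),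
      asFun (ofExtend (c.app W y)) • secRes _ (openPart_le_left (f ⁻¹ᵁ U) W)
        (_root_.pullbackLocal f m) = secRes _ (openPart_le_right (f ⁻¹ᵁ U) W) y := fun W y => by
    rw [← ofExtend_toOpenExtension, ← key]
    rfl
  have hone : asFun (ofExtend (c.app (f ⁻¹ᵁ U) (_root_.pullbackLocal f m))) = 1 := by
    rw [hc', pullbackCoord]
    have : localCoord hm m = 1 := IsFrame.coord_eq _ (one_smul _ _).symm
    rw [this, map_one, map_one]
  rw [isFrame_iff]
  intro W h
  have hW : W ≤ openPart (f ⁻¹ᵁ U) W := le_openPart h le_rfl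
  have hcoord : ∀ r : Γ(X, W), asFun (ofExtend (c.app W (r • secRes _ h
      (_root_.pullbackLocal f m)))) = funRes X (openPart_le_right (f ⁻¹ᵁ U) W) r := fun r => by
    rw [Scheme.Modules.Hom.app_smul, ofExtend_smul, asFun_smul, hom_secRes, secRes_ofExtend,
      asFun_secRes, hone, map_one, mul_one]
  constructor
  · intro r r' hr
    have h1 := (hcoord r).symm.trans ((congrArg (fun z => asFun (ofExtend (c.app W z))) hr).trans
      (hcoord r'))
    have h2 := congrArg (funRes X hW) h1
    rwa [funRes_funRes, funRes_funRes, funRes_rfl, funRes_rfl] at h2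
  · intro y
    refine ⟨funRes X hW (asFun (ofExtend (c.app W y))), ?_⟩
    have h1 := congrArg (secRes _ hW) (key2 W y)
    rw [secRes_smul, secRes_secRes, secRes_secRes, secRes_rfl] at h1
    exact h1

theorem HasFrames.pullback {M : Y.Modules} (hM : HasFrames M) :
    HasFrames ((Scheme.Modules.pullback f).obj M) := by
  intro p
  obtain ⟨U, m, hp, hm⟩ := hM (f p)
  exact ⟨f ⁻¹ᵁ U, _, hp, hm.pullbackLocal f⟩

end

/-! ### The coordinate ring of the space of representations -/

/-- Concatenation of paths. -/
def QPath.append {ι : Type} {A : ι → ι → Type u} {i j : ι} (p : QPath A i j) :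
    ∀ {l : ι}, QPath A j l → QPath A i l
  | _, .nil => p
  | _, .cons q e => .cons (p.append q) e

theorem evalPath_append {ι : Type} {A : ι → ι → Type u} {C : Type*} [Category.{u} C] {E : ι → C}
    (a : ∀ i j, A i j → (E j ⟶ E i)) {i j l : ι} (p : QPath A i j) (q : QPath A j l) :
    evalPath a (p.append q) = evalPath a q ≫ evalPath a p := by
  induction q with
  | nil => exact (Category.id_comp _).symm
  | cons q e ih => rw [QPath.append, evalPath, evalPath, ih, Category.assoc]

namespace QuiverPresentation

section

variable {k : Type u} [CommRing k] {C : Type*} [Category.{u} C] [Preadditive C] [Linear k C]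
  {ι : Type} {E : ι → C} (Q : QuiverPresentation k E)

theorem pathMonomial_append {i j l : ι} (p : QPath Q.Arrow i j) (q : QPath Q.Arrow j l) :
    Q.pathMonomial (p.append q) = Q.pathMonomial q * Q.pathMonomial p := by
  induction q with
  | nil => exact (one_mul _).symm
  | cons q e ih => rw [QPath.append, pathMonomial, pathMonomial, ih, mul_assoc]

/-- The evaluation of linear combinations of paths. -/
def evalLin (i j : ι) : (QPath Q.Arrow i j →₀ k) →ₗ[k] (E j ⟶ E i) :=
  Finsupp.linearCombination k (fun p => evalPath Q.toHom p)

/-- The function on the space of representations given by a linear combination of paths. -/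
def monLin (i j : ι) : (QPath Q.Arrow i j →₀ k) →ₗ[k] Q.RepRing :=
  (Ideal.Quotient.mkₐ k Q.repIdeal).toLinearMap ∘ₗ
    Finsupp.linearCombination k (fun p => Q.pathMonomial p)

/-- The difference of `c` and `d` is a relation of the quiver. This makes `val` independent of the
chosen combination of paths. -/
theorem monLin_eq_of_evalLin_eq {i j : ι} {c d : QPath Q.Arrow i j →₀ k}
    (h : Q.evalLin i j c = Q.evalLin i j d) : Q.monLin i j c = Q.monLin i j d := by
  rw [← sub_eq_zero, ← map_sub]
  refine Ideal.Quotient.eq_zero_iff_mem.mpr (Ideal.subset_span ⟨i, j, c - d, ?_, rfl⟩)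
  refine LinearMap.mem_ker.mpr ?_
  change Q.evalLin i j (c - d) = 0
  rw [map_sub, h, sub_self]

/-- The function on the space of representations by which a morphism `E j ⟶ E i` acts. -/
def val {i j : ι} : (E j ⟶ E i) →ₗ[k] Q.RepRing where
  toFun f := Q.monLin i j (Q.surjective i j f).choose
  map_add' f g := by
    rw [← map_add]
    refine Q.monLin_eq_of_evalLin_eq ?_
    rw [map_add]
    exact (Q.surjective i j _).choose_spec.trans (congrArg₂ (· + ·)
      (Q.surjective i j f).choose_spec.symm (Q.surjective i j g).choose_spec.symm)
  map_smul' c f := by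
    rw [RingHom.id_apply, ← map_smul]
    refine Q.monLin_eq_of_evalLin_eq ?_
    rw [map_smul]
    exact (Q.surjective i j _).choose_spec.trans
      (congrArg (c • ·) (Q.surjective i j f).choose_spec.symm)

theorem val_evalLin {i j : ι} (c : QPath Q.Arrow i j →₀ k) :
    Q.val (Q.evalLin i j c) = Q.monLin i j c :=
  Q.monLin_eq_of_evalLin_eq (Q.surjective i j _).choose_spec

theorem val_evalPath {i j : ι} (p : QPath Q.Arrow i j) :
    Q.val (evalPath Q.toHom p) = Ideal.Quotient.mk Q.repIdeal (Q.pathMonomial p) := by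
  have h := Q.val_evalLin (Finsupp.single p (1 : k))
  rw [evalLin, monLin, LinearMap.comp_apply, Finsupp.linearCombination_single,
    Finsupp.linearCombination_single, one_smul, one_smul] at h
  exact h

theorem val_id (i : ι) : Q.val (𝟙 (E i)) = 1 := Q.val_evalPath (.nil : QPath Q.Arrow i i)

theorem val_toHom {i j : ι} (e : Q.Arrow i j) :
    Q.val (Q.toHom i j e) = Ideal.Quotient.mk Q.repIdeal (MvPolynomial.X ⟨i, j, e⟩) := by
  have h := Q.val_evalPath (.cons .nil e)
  rw [evalPath, evalPath, Category.comp_id] at h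
  rw [h, pathMonomial, pathMonomial, mul_one]

theorem evalLin_induction {i j : ι} {motive : (E j ⟶ E i) → Prop}
    (path : ∀ p : QPath Q.Arrow i j, motive (evalPath Q.toHom p))
    (zero : motive 0)
    (add : ∀ f g, motive f → motive g → motive (f + g))
    (smul : ∀ (c : k) f, motive f → motive (c • f)) (f : E j ⟶ E i) : motive f := by
  obtain ⟨c, rfl⟩ := Q.surjective i j f
  induction c using Finsupp.induction_linear with
  | zero => rw [map_zero]; exact zero
  | add c d hc hd => rw [map_add]; exact add _ _ hc hd
  | single p a => rw [Finsupp.linearCombination_single]; exact smul _ _ (path p)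

/-- By bilinearity only paths matter, and for them composition is concatenation. -/
theorem val_comp {i j l : ι} (g : E l ⟶ E j) (f : E j ⟶ E i) :
    Q.val (g ≫ f) = Q.val g * Q.val f := by
  induction f using Q.evalLin_induction with
  | path p =>
    induction g using Q.evalLin_induction with
    | path q =>
      rw [← evalPath_append, val_evalPath, val_evalPath, val_evalPath, pathMonomial_append, map_mul]
    | zero => rw [Limits.zero_comp, map_zero, map_zero, zero_mul]
    | add f g hf hg => rw [Preadditive.add_comp, map_add, map_add, hf, hg, add_mul]
    | smul c f hf => rw [Linear.smul_comp, map_smul, map_smul, hf, smul_mul_assoc]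
  | zero => rw [Limits.comp_zero, map_zero, map_zero, mul_zero]
  | add f g hf hg => rw [Preadditive.comp_add, map_add, map_add, hf, hg, mul_add]
  | smul c f hf => rw [Linear.comp_smul, map_smul, map_smul, hf, mul_smul_comm]

/-- The subalgebra generated by the functions by which endomorphisms act. -/
def loopAlgebra : Subalgebra k Q.RepRing :=
  Algebra.adjoin k {b | ∃ (i : ι) (f : E i ⟶ E i), b = Q.val f}

theorem val_mem_loopAlgebra {i : ι} (f : E i ⟶ E i) : Q.val f ∈ Q.loopAlgebra :=
  Algebra.subset_adjoin ⟨i, f, rfl⟩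

/-- A product of functions given by morphisms whose sources and targets cancel is a product of
functions given by endomorphisms. -/
theorem prod_val_mem_loopAlgebra [DecidableEq ι] (n : ℕ) :
    ∀ s : Multiset (Σ i j : ι, (E j ⟶ E i)), s.card = n →
      s.map (fun e => e.1) = s.map (fun e => e.2.1) →
      (s.map fun e => Q.val e.2.2).prod ∈ Q.loopAlgebra := by
  induction n with
  | zero =>
    intro s hs _
    rw [Multiset.card_eq_zero.mp hs, Multiset.map_zero, Multiset.prod_zero]
    exact one_mem _
  | succ n ih =>
    intro s hs h
    obtain ⟨a, ha⟩ := Multiset.card_pos_iff_exists_mem.mp (by rw [hs]; exact n.succ_pos)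
    obtain ⟨s, rfl⟩ := Multiset.exists_cons_of_mem ha
    obtain ⟨i, j, f⟩ := a
    rw [Multiset.card_cons, add_left_inj] at hs
    rw [Multiset.map_cons, Multiset.map_cons] at h
    rw [Multiset.map_cons, Multiset.prod_cons]
    by_cases hij : i = j
    · subst hij
      exact mul_mem (Q.val_mem_loopAlgebra f) (ih s hs (Multiset.cons_inj_right _ |>.mp h))
    -- As `i ≠ j`, the index `j` has to be balanced by another factor `g : E l ⟶ E j`. Replacing the
    -- two factors by `g ≫ f` keeps the balance and the product and shortens the list by one.
    · have hj : j ∈ s.map fun e => e.1 := by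
        have h1 : j ∈ i ::ₘ s.map fun e => e.1 := by
          rw [h]
          exact Multiset.mem_cons_self _ _
        rcases Multiset.mem_cons.mp h1 with h1 | h1
        · exact absurd h1.symm hij
        · exact h1
      obtain ⟨⟨j', l, g⟩, hg, hj'⟩ := Multiset.mem_map.mp hj
      change j' = j at hj'
      subst hj'
      obtain ⟨s, rfl⟩ := Multiset.exists_cons_of_mem hg
      rw [Multiset.map_cons, Multiset.map_cons] at h
      have h2 := ih (⟨i, l, g ≫ f⟩ ::ₘ s) (by rw [← hs, Multiset.card_cons, Multiset.card_cons]) (by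
        rw [Multiset.map_cons, Multiset.map_cons]
        rw [Multiset.cons_swap] at h
        exact (Multiset.cons_inj_right _).mp h)
      rw [Multiset.map_cons, Multiset.prod_cons, val_comp] at h2
      rw [Multiset.map_cons, Multiset.prod_cons, ← mul_assoc, mul_comm (Q.val f)]
      exact h2

end

/-! ### Torus invariants are generated by loops. -/

section

variable {k : Type u} [Field k] {C : Type*} [Category.{u} C] [Preadditive C] [Linear k C]
  {ι : Type} {E : ι → C} (Q : QuiverPresentation k E)

/-- The character by which the torus acts on a monomial. -/
def monomialChar (m : (Σ i j, Q.Arrow i j) →₀ ℕ) : (ι → kˣ) →* k where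
  toFun g := (m.toMultiset.map fun e => (((g e.2.1)⁻¹ * g e.1 : kˣ) : k)).prod
  map_one' := by simp
  map_mul' g h := by
    rw [← Multiset.prod_map_mul]
    congr 1
    refine Multiset.map_congr rfl fun e _ => ?_
    rw [← Units.val_mul]
    congr 1
    rw [Pi.mul_apply, Pi.mul_apply, mul_inv]
    exact mul_mul_mul_comm _ _ _ _

theorem monomial_eq_prod (m : (Σ i j, Q.Arrow i j) →₀ ℕ) :
    (MvPolynomial.monomial m 1 : Q.FreeRing) = (m.toMultiset.map MvPolynomial.X).prod := by
  rw [MvPolynomial.monomial_eq, map_one, one_mul, Finsupp.toMultiset_map, Finsupp.prod_toMultiset,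
    Finsupp.prod_mapDomain_index (fun _ => pow_zero _) (fun _ _ _ => pow_add _ _ _)]

theorem freeAct_monomial (g : ι → kˣ) (m : (Σ i j, Q.Arrow i j) →₀ ℕ) :
    Q.freeAct g (MvPolynomial.monomial m 1) =
      Q.monomialChar m g • MvPolynomial.monomial m 1 := by
  rw [monomial_eq_prod, map_multiset_prod, Multiset.map_map, MvPolynomial.smul_eq_C_mul,
    monomialChar]
  change _ = MvPolynomial.C (Multiset.prod _) * _
  rw [map_multiset_prod, Multiset.map_map, ← Multiset.prod_map_mul]
  congr 1
  refine Multiset.map_congr rfl fun e _ => ?_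
  rw [Function.comp_apply, freeAct, MvPolynomial.aeval_X]
  rfl

/-- An invariant function is a linear combination of invariant monomials. -/
theorem mem_span_of_mem_invariants {b : Q.RepRing} (hb : b ∈ Q.invariants) :
    b ∈ Submodule.span k {b | ∃ m, Q.monomialChar m = 1 ∧
      b = Ideal.Quotient.mk Q.repIdeal (MvPolynomial.monomial m 1)} := by
  classical
  obtain ⟨P, rfl⟩ := Ideal.Quotient.mk_surjective b
  let x : ((Σ i j, Q.Arrow i j) →₀ ℕ) → Q.RepRing := fun m =>
    Ideal.Quotient.mk Q.repIdeal (MvPolynomial.monomial m (P.coeff m))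
  -- The weight components of `P`: its terms grouped by the character of the torus.
  let w : ((ι → kˣ) →* k) → Q.RepRing := fun χ =>
    ∑ m ∈ P.support with Q.monomialChar m = χ, x m
  -- The trivial character is put in, even if it has no terms, to carry the constant part of the
  -- relation `hinv`.
  let S : Finset ((ι → kˣ) →* k) := insert 1 (P.support.image Q.monomialChar)
  have hx : ∀ g m, Q.act g (x m) = Q.monomialChar m g • x m := fun g m => by
    change Ideal.Quotient.mk Q.repIdeal (Q.freeAct g _) = _
    have h1 : (MvPolynomial.monomial m (P.coeff m) : Q.FreeRing) =
        P.coeff m • MvPolynomial.monomial m 1 := by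
      rw [MvPolynomial.smul_monomial, smul_eq_mul, mul_one]
    change _ = _ • Ideal.Quotient.mk Q.repIdeal (MvPolynomial.monomial m (P.coeff m))
    rw [h1, map_smul, freeAct_monomial, smul_comm]
    rfl
  have hsum : Ideal.Quotient.mk Q.repIdeal P = ∑ χ ∈ S, w χ := by
    conv_lhs => rw [P.as_sum, map_sum]
    exact (Finset.sum_fiberwise_of_maps_to (fun m hm =>
      Finset.mem_insert_of_mem (Finset.mem_image_of_mem _ hm)) x).symm
  have hact : ∀ g, Q.act g (Ideal.Quotient.mk Q.repIdeal P) = ∑ χ ∈ S, χ g • w χ := fun g => by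
    rw [hsum, map_sum]
    refine Finset.sum_congr rfl fun χ _ => ?_
    rw [map_sum, Finset.smul_sum]
    refine Finset.sum_congr rfl fun m hm => ?_
    rw [hx, (Finset.mem_filter.mp hm).2]
  have hinv : ∀ g, ∑ χ ∈ S, (χ g - 1) • w χ = 0 := fun g => by
    simp only [sub_smul, one_smul, Finset.sum_sub_distrib]
    rw [← hact, ← hsum, sub_eq_zero]
    exact (Algebra.mem_iInf.mp hb g : _)
  have hzero : ∀ χ ∈ S, χ ≠ 1 → w χ = 0 := by
    intro χ hχ hne
    -- A linear functional that does not vanish on `w χ` turns `hinv` into a scalar relation between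
    -- characters.
    by_contra hw
    obtain ⟨ℓ, hℓ⟩ := Module.Projective.exists_dual_ne_zero k hw
    -- Independence of characters, for Σ χ(g) ℓ(w χ) - 1(g) Σ ℓ(w ψ) = 0. The coefficient at `χ ≠ 1`
    -- is `ℓ (w χ)`; the subtracted sum enters only at the trivial character.
    have hli := linearIndependent_iff'.mp (linearIndependent_monoidHom (ι → kˣ) k) S
      (fun χ => ℓ (w χ) - if χ = 1 then ∑ ψ ∈ S, ℓ (w ψ) else 0) (by
        funext g
        rw [Finset.sum_apply, Pi.zero_apply]
        have h1 := congrArg ℓ (hinv g)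
        rw [map_sum, map_zero] at h1
        simp only [map_smul, smul_eq_mul, sub_mul, one_mul, Finset.sum_sub_distrib] at h1
        simp only [Pi.smul_apply, smul_eq_mul, sub_mul, ite_mul, zero_mul,
          Finset.sum_sub_distrib, Finset.sum_ite_eq', MonoidHom.one_apply, mul_one]
        rw [if_pos (Finset.mem_insert_self _ _)]
        simpa only [mul_comm] using h1) χ hχ
    rw [if_neg hne, sub_zero] at hli
    exact hℓ hli
  rw [hsum]
  refine Submodule.sum_mem _ fun χ hχ => ?_
  by_cases h1 : χ = 1
  · refine Submodule.sum_mem _ fun m hm => ?_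
    have h2 : x m = P.coeff m • Ideal.Quotient.mk Q.repIdeal (MvPolynomial.monomial m 1) := by
      change Ideal.Quotient.mk Q.repIdeal (MvPolynomial.monomial m (P.coeff m)) =
        P.coeff m • Ideal.Quotient.mkₐ k Q.repIdeal _
      rw [← map_smul, MvPolynomial.smul_monomial, smul_eq_mul, mul_one]
      rfl
    rw [h2]
    exact Submodule.smul_mem _ _ (Submodule.subset_span
      ⟨m, (Finset.mem_filter.mp hm).2.trans h1, rfl⟩)
  · rw [hzero χ hχ h1]
    exact zero_mem _

/-- Otherwise every element of the infinite field `k` would be a root of X^(n+1) - X. -/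
theorem exists_unit_pow_ne_one [Infinite k] {n : ℕ} (hn : n ≠ 0) : ∃ c : kˣ, c ^ n ≠ 1 := by
  by_contra! h
  refine FiniteField.X_pow_card_sub_X_ne_zero k (p := n + 1) (by omega)
    (Polynomial.eq_zero_of_infinite_isRoot _ (Set.infinite_univ.mono fun x _ => ?_))
  change Polynomial.IsRoot _ x
  rw [Polynomial.IsRoot.def, Polynomial.eval_sub, Polynomial.eval_pow, Polynomial.eval_X]
  by_cases hx : x = 0
  · rw [hx, zero_pow n.succ_ne_zero, sub_zero]
  · have h1 := congrArg Units.val (h (Units.mk0 x hx))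
    rw [Units.val_pow_eq_pow_val, Units.val_mk0, Units.val_one] at h1
    rw [pow_succ, h1, one_mul, sub_self]

/-- Test the character on the torus element that is `c` at one node and 1 at the others: the numbers
of arrows out of and into that node are exponents giving the same power of `c`, for every unit `c`.
-/
theorem map_eq_of_monomialChar_eq_one [Infinite k] [DecidableEq ι]
    {m : (Σ i j, Q.Arrow i j) →₀ ℕ} (h : Q.monomialChar m = 1) :
    m.toMultiset.map (fun e => e.1) = m.toMultiset.map (fun e => e.2.1) := by
  have key : ∀ g : ι → kˣ, ((m.toMultiset.map fun e => e.1).map g).prod =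
      ((m.toMultiset.map fun e => e.2.1).map g).prod := fun g => by
    have h1 : ((m.toMultiset.map fun e => (g e.2.1)⁻¹ * g e.1).prod : kˣ) = 1 := by
      have h0 := DFunLike.congr_fun h g
      apply Units.ext
      rw [← Units.coeHom_apply, map_multiset_prod, Multiset.map_map]
      exact h0
    rw [Multiset.prod_map_mul, Multiset.prod_map_inv, inv_mul_eq_one] at h1
    rw [Multiset.map_map, Multiset.map_map]
    exact h1.symm
  have hcount : ∀ (s : Multiset ι) (i : ι) (c : kˣ),
      (s.map (Function.update (1 : ι → kˣ) i c)).prod = c ^ s.count i := by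
    intro s i c
    induction s using Multiset.induction_on with
    | empty => simp
    | cons a s ih =>
      rw [Multiset.map_cons, Multiset.prod_cons, ih, Multiset.count_cons]
      by_cases hai : i = a
      · subst hai
        rw [Function.update_self, if_pos rfl, pow_succ, mul_comm]
      · rw [Function.update_of_ne (Ne.symm hai), if_neg hai, Pi.one_apply, one_mul, add_zero]
  ext i
  by_contra hne
  have hpow : ∀ c : kˣ, c ^ (m.toMultiset.map fun e => e.1).count i =
      c ^ (m.toMultiset.map fun e => e.2.1).count i := fun c => by
    rw [← hcount, ← hcount, key]
  rcases lt_or_gt_of_ne hne with hlt | hlt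
  · obtain ⟨c, hc⟩ := exists_unit_pow_ne_one (k := k) (Nat.sub_ne_zero_of_lt hlt)
    refine hc ?_
    rw [pow_sub _ hlt.le, hpow, mul_inv_cancel]
  · obtain ⟨c, hc⟩ := exists_unit_pow_ne_one (k := k) (Nat.sub_ne_zero_of_lt hlt)
    refine hc ?_
    rw [pow_sub _ hlt.le, hpow, mul_inv_cancel]

/-- Invariants are generated by the functions by which endomorphisms act. -/
theorem invariants_le_loopAlgebra [Infinite k] [DecidableEq ι] : Q.invariants ≤ Q.loopAlgebra := by
  intro b hb
  have hb' := Q.mem_span_of_mem_invariants hb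
  refine Submodule.span_le (p := Subalgebra.toSubmodule Q.loopAlgebra) |>.mpr ?_ hb'
  rintro _ ⟨m, hm, rfl⟩
  have h := Q.prod_val_mem_loopAlgebra _
    (m.toMultiset.map fun e => (⟨e.1, e.2.1, Q.toHom _ _ e.2.2⟩ : Σ i j : ι, (E j ⟶ E i))) rfl (by
      rw [Multiset.map_map, Multiset.map_map]
      exact Q.map_eq_of_monomialChar_eq_one hm)
  rw [Multiset.map_map] at h
  rw [monomial_eq_prod, map_multiset_prod, Multiset.map_map]
  have h2 : (⇑(Ideal.Quotient.mk Q.repIdeal) ∘ MvPolynomial.X) =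
      ((fun e : Σ i j : ι, (E j ⟶ E i) => Q.val e.2.2) ∘
        fun e : Σ i j, Q.Arrow i j => ⟨e.1, e.2.1, Q.toHom _ _ e.2.2⟩) :=
    funext fun e => (Q.val_toHom e.2.2).symm
  rw [h2]
  exact h

/-- A path from `i` to `i` is scaled by g_i⁻¹ g_i = 1. -/
theorem val_mem_invariants {i : ι} (f : E i ⟶ E i) : Q.val f ∈ Q.invariants := by
  rw [invariants, Algebra.mem_iInf]
  intro g
  change Q.act g (Q.val f) = Q.val f
  induction f using Q.evalLin_induction with
  | path p =>
    rw [val_evalPath]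
    change Ideal.Quotient.mk Q.repIdeal (Q.freeAct g _) = _
    rw [freeAct_pathMonomial, inv_mul_cancel, Units.val_one, one_smul]
  | zero => rw [map_zero, map_zero]
  | add f g hf hg => rw [map_add, map_add, hf, hg]
  | smul c f hf => rw [map_smul, map_smul, hf]

theorem loopAlgebra_le_invariants : Q.loopAlgebra ≤ Q.invariants := by
  rw [loopAlgebra, Algebra.adjoin_le_iff]
  rintro _ ⟨i, f, rfl⟩
  exact Q.val_mem_invariants f

end

end QuiverPresentation

/-! ### Evaluation of functions on representations in frames -/

section

variable {k : Type u} [CommRing k] {V : Scheme.{u}} [V.Over (Spec (.of k))]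

theorem funRes_scalar {W U : V.Opens} (h : W ≤ U) (c : k) :
    funRes V h (scalar k V U c) = scalar k V W c :=
  funRes_funRes h le_top ((V ↘ Spec (.of k)).appTop ((Scheme.ΓSpecIso (.of k)).inv c))

theorem smul_app {M N : V.Modules} (c : k) (f : M ⟶ N) (U : V.Opens) (x : Γ(M, U)) :
    (c • f).app U x = scalar k V U c • f.app U x := by
  change (globalSMul N (scalar k V ⊤ c)).app U (f.app U x) = _
  rw [globalSMul_app]
  congr 1
  exact funRes_scalar le_top c

namespace QuiverPresentation

variable {ι : Type} {E : ι → V.Modules} (Q : QuiverPresentation k E)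

/-- The coordinates `r` describe the arrows in the frames `m`. -/
def IsCoord {U : V.Opens} (m : ∀ i, Γ(E i, U)) (r : (Σ i j, Q.Arrow i j) → Γ(V, U)) : Prop :=
  ∀ (i j : ι) (e : Q.Arrow i j), (Q.toHom i j e).app U (m j) = r ⟨i, j, e⟩ • m i

variable {Q} {U : V.Opens} {m : ∀ i, Γ(E i, U)} {r : (Σ i j, Q.Arrow i j) → Γ(V, U)}

theorem exists_isCoord (hm : ∀ i, IsFrame (m i)) : ∃ r, Q.IsCoord m r :=
  ⟨fun e => (hm e.1).coord ((Q.toHom e.1 e.2.1 e.2.2).app U (m e.2.1)),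
    fun i _ _ => ((hm i).coord_smul _).symm⟩

theorem IsCoord.evalPath (hr : Q.IsCoord m r) {i j : ι} (p : QPath Q.Arrow i j) :
    (evalPath Q.toHom p).app U (m j) =
      MvPolynomial.eval₂Hom (scalar k V U) r (Q.pathMonomial p) • m i := by
  induction p with
  | nil =>
    rw [pathMonomial, map_one, one_smul]
    rfl
  | cons p e ih =>
    rw [pathMonomial, map_mul, MvPolynomial.eval₂Hom_X', mul_smul, ← ih,
      ← Scheme.Modules.Hom.app_smul, ← hr]
    rfl

theorem IsCoord.evalLin (hr : Q.IsCoord m r) {i j : ι} (c : QPath Q.Arrow i j →₀ k) :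
    (Q.evalLin i j c).app U (m j) = MvPolynomial.eval₂Hom (scalar k V U) r
      (Finsupp.linearCombination k (fun p => Q.pathMonomial p) c) • m i := by
  rw [QuiverPresentation.evalLin]
  induction c using Finsupp.induction_linear with
  | zero =>
    rw [map_zero, map_zero, map_zero, zero_smul]
    rfl
  | add c d hc hd =>
    rw [map_add, map_add, map_add, add_smul, ← hc, ← hd]
    rfl
  | single p a =>
    rw [Finsupp.linearCombination_single, Finsupp.linearCombination_single, smul_app, hr.evalPath,
      MvPolynomial.smul_eq_C_mul, map_mul, MvPolynomial.eval₂Hom_C, mul_smul]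

/-- The evaluation of functions on representations at the coordinates of the arrows. -/
def evalCoord (hr : Q.IsCoord m r) (hm : ∀ i, IsFrame (m i)) : Q.RepRing →+* Γ(V, U) :=
  Ideal.Quotient.lift Q.repIdeal (MvPolynomial.eval₂Hom (scalar k V U) r) (by
    intro a ha
    have hle : Q.repIdeal ≤ RingHom.ker (MvPolynomial.eval₂Hom (scalar k V U) r) := by
      rw [repIdeal, Ideal.span_le]
      rintro _ ⟨i, j, c, hc, rfl⟩
      refine (hm i).smul_inj ?_
      rw [← hr.evalLin, zero_smul]
      have h0 : Q.evalLin i j c = 0 := hc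
      rw [h0]
      rfl
    exact hle ha)

theorem evalCoord_val (hr : Q.IsCoord m r) (hm : ∀ i, IsFrame (m i)) {i j : ι} (f : E j ⟶ E i) :
    evalCoord hr hm (Q.val f) • m i = f.app U (m j) := by
  obtain ⟨c, rfl⟩ := Q.surjective i j f
  change evalCoord hr hm (Q.val (Q.evalLin i j c)) • _ = (Q.evalLin i j c).app U (m j)
  rw [val_evalLin, hr.evalLin]
  rfl

theorem evalCoord_algebraMap (hr : Q.IsCoord m r) (hm : ∀ i, IsFrame (m i)) (c : k) :
    evalCoord hr hm (algebraMap k Q.RepRing c) = scalar k V U c :=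
  MvPolynomial.eval₂Hom_C _ _ _

theorem evalCoord_val_globalSMul (hr : Q.IsCoord m r) (hm : ∀ i, IsFrame (m i)) (i : ι)
    (s : Γ(V, ⊤)) : evalCoord hr hm (Q.val (globalSMul (E i) s)) = funRes V le_top s :=
  (hm i).smul_inj (evalCoord_val hr hm _)

end QuiverPresentation

/-! ### Endomorphisms of line bundles -/

/-- Over `U ⊓ W` every section is a multiple of `m`, and restriction to that open set loses nothing
in `N`. -/
theorem hom_ext_of_frame [IsIntegral V] {M N : V.Modules} (hN : TorsionFree N)
    {U : V.Opens} (hU : (U : Set V).Nonempty) {m : Γ(M, U)} (hm : IsFrame m) {f g : M ⟶ N}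
    (h : f.app U m = g.app U m) : f = g := by
  refine modules_hom_ext fun W x => ?_
  rcases Set.eq_empty_or_nonempty (W : Set V) with hW | hW
  · refine sec_ext fun p hp => ?_
    exact absurd (show p ∈ (W : Set V) from hp) (by simp [hW])
  · refine hN _ _ (inf_le_right : U ⊓ W ≤ W) (inter_nonempty hU hW) ?_
    obtain ⟨r, hr⟩ := (hm.restrict (inf_le_left : U ⊓ W ≤ U)).exists_eq (secRes M inf_le_right x)
    rw [← hom_secRes, ← hom_secRes, hr, Scheme.Modules.Hom.app_smul, Scheme.Modules.Hom.app_smul,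
      hom_secRes, hom_secRes, h]

/-- In a frame `m` the endomorphism is multiplication by the coordinate of `f m`. This function does
not depend on the frame, so the local functions glue. -/
theorem exists_eq_globalSMul {V : Scheme.{u}} [IsIntegral V] {M : V.Modules} (hM : HasFrames M)
    (f : M ⟶ M) : ∃ s : Γ(V, ⊤), f = globalSMul M s := by
  obtain ⟨s, hs⟩ := exists_glue_fun (X := V) (U := ⊤)
    -- The local condition carries the existence of a frame, which makes `r` unique.
    (fun W r => ∀ x : Γ(M, W), f.app W x = r • x ∧ ∃ m : Γ(M, W), IsFrame m)
    (fun W T h r hr x => by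
      obtain ⟨-, m, hm⟩ := hr 0
      obtain ⟨a, rfl⟩ := (hm.restrict h).exists_eq x
      refine ⟨?_, _, hm.restrict h⟩
      rw [Scheme.Modules.Hom.app_smul, hom_secRes, (hr m).1, secRes_smul, smul_comm])
    (fun W r r' hr hr' => by
      obtain ⟨-, m, hm⟩ := hr 0
      exact hm.smul_inj ((hr m).1.symm.trans (hr' m).1))
    (fun p _ => by
      obtain ⟨U, m, hp, hm⟩ := hM p
      obtain ⟨r, hr⟩ := hm.exists_eq (f.app U m)
      refine ⟨U, le_top, hp, r, fun x => ?_⟩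
      obtain ⟨a, rfl⟩ := hm.exists_eq x
      exact ⟨by rw [Scheme.Modules.Hom.app_smul, hr, smul_comm], m, hm⟩)
  refine ⟨s, modules_hom_ext fun U x => sec_ext fun p hp => ?_⟩
  obtain ⟨W, hW, hpW, h⟩ := hs p trivial
  refine ⟨U ⊓ W, inf_le_left, ⟨hp, hpW⟩, ?_⟩
  obtain ⟨-, m, hm⟩ := h 0
  obtain ⟨a, ha⟩ := (hm.restrict (inf_le_right : U ⊓ W ≤ W)).exists_eq (secRes M inf_le_left x)
  rw [← hom_secRes, ← hom_secRes, ha, Scheme.Modules.Hom.app_smul, Scheme.Modules.Hom.app_smul,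
    hom_secRes, hom_secRes, (h m).1, globalSMul_app]
  rfl

end

/-! ### The tautological map -/

namespace QuiverPresentation

variable {k : Type u} [Field k] {V : Scheme.{u}} [V.Over (Spec (.of k))]
  {n : ℕ} {E : Fin n → V.Modules} (Q : QuiverPresentation k E)

/-- An invariant of representations gives a global function. -/
theorem exists_function_of_mem_invariants [IsIntegral V] [Infinite k] (hE : ∀ i, HasFrames (E i)) {b : Q.RepRing}
    (hb : b ∈ Q.invariants) : ∃ s : Γ(V, ⊤), ∀ (U : V.Opens) (m : ∀ i, Γ(E i, U))
      (r : (Σ i j, Q.Arrow i j) → Γ(V, U)) (hr : Q.IsCoord m r) (hm : ∀ i, IsFrame (m i)),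
      evalCoord hr hm b = funRes V le_top s := by
  have hb' := Q.invariants_le_loopAlgebra hb
  clear hb
  -- For a generator the endomorphism is itself a global function; sums and products of functions
  -- match those of invariants because evaluation in frames is a ring homomorphism.
  induction hb' using Algebra.adjoin_induction with
  | mem b hb =>
    obtain ⟨i, f, rfl⟩ := hb
    obtain ⟨s, rfl⟩ := exists_eq_globalSMul (hE i) f
    exact ⟨s, fun U m r hr hm => evalCoord_val_globalSMul hr hm i s⟩
  | algebraMap c =>
    exact ⟨scalar k V ⊤ c, fun U m r hr hm =>
      (evalCoord_algebraMap hr hm c).trans (funRes_scalar le_top c).symm⟩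
  | add a b _ _ ha hb =>
    obtain ⟨s, hs⟩ := ha
    obtain ⟨t, ht⟩ := hb
    exact ⟨s + t, fun U m r hr hm => by rw [map_add, map_add, hs, ht]⟩
  | mul a b _ _ ha hb =>
    obtain ⟨s, hs⟩ := ha
    obtain ⟨t, ht⟩ := hb
    exact ⟨s * t, fun U m r hr hm => by rw [map_mul, map_mul, hs, ht]⟩

theorem isTautologicalPullback_iff {T : Q.invariants →+* Γ(V, ⊤)} :
    IsTautologicalPullback Q T ↔ ∀ (U : V.Opens) (m : ∀ i, Γ(E i, U))
      (r : (Σ i j, Q.Arrow i j) → Γ(V, U)) (hr : Q.IsCoord m r) (hm : ∀ i, IsFrame (m i))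
      (b : Q.invariants), funRes V le_top (T b) = evalCoord hr hm b := by
  constructor
  · rintro h U m r hr hm ⟨b, hb⟩
    obtain ⟨P, rfl⟩ := Ideal.Quotient.mk_surjective b
    exact h U m hm r hr P hb
  · intro h U m hm r hr P hP
    exact h U m r hr hm ⟨_, hP⟩

theorem exists_coordinates [IsIntegral V] (hE : ∀ i, HasFrames (E i)) :
    ∃ (U : V.Opens) (m : ∀ i, Γ(E i, U)) (r : (Σ i j, Q.Arrow i j) → Γ(V, U)),
      (U : Set V).Nonempty ∧ Q.IsCoord m r ∧ ∀ i, IsFrame (m i) := by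
  obtain ⟨p⟩ : Nonempty V := inferInstance
  obtain ⟨U, m, hp, -, hm⟩ := exists_common_frames hE (p := p) (U := ⊤) trivial
  obtain ⟨r, hr⟩ := exists_isCoord (Q := Q) hm
  exact ⟨U, m, r, ⟨p, hp⟩, hr, hm⟩

/-- Pullback of functions along the tautological map is well-defined. -/
theorem existsUnique_isTautologicalPullback [IsIntegral V] [Infinite k] (hE : ∀ i, HasFrames (E i)) :
    ∃! T : Q.invariants →+* Γ(V, ⊤), IsTautologicalPullback Q T := by
  obtain ⟨U, m, r, hU, hr, hm⟩ := Q.exists_coordinates hE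
  -- A single chart suffices: restriction to it is injective, so the ring identities and the
  -- uniqueness of `T` can be read off there.
  have hinj := funRes_injective (le_top : U ≤ ⊤) hU
  choose τ hτ using fun b : Q.invariants => Q.exists_function_of_mem_invariants hE b.2
  let T : Q.invariants →+* Γ(V, ⊤) :=
    { toFun := τ
      map_one' := hinj (by rw [← hτ 1 U m r hr hm, map_one]; exact map_one _)
      map_zero' := hinj (by rw [← hτ 0 U m r hr hm, map_zero]; exact map_zero _)
      map_mul' := fun a b => hinj (by
        rw [← hτ (a * b) U m r hr hm, map_mul, ← hτ a U m r hr hm, ← hτ b U m r hr hm]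
        exact map_mul _ _ _)
      map_add' := fun a b => hinj (by
        rw [← hτ (a + b) U m r hr hm, map_add, ← hτ a U m r hr hm, ← hτ b U m r hr hm]
        exact map_add _ _ _) }
  refine ⟨T, Q.isTautologicalPullback_iff.mpr fun U m r hr hm b => (hτ b U m r hr hm).symm,
    fun T' hT' => RingHom.ext fun b => hinj ?_⟩
  rw [Q.isTautologicalPullback_iff.mp hT' U m r hr hm]
  exact hτ b U m r hr hm

/-- The invariant by which a global function acts at a node. -/
def nodeFunction (i : Fin n) (s : Γ(V, ⊤)) : Q.invariants :=
  ⟨Q.val (globalSMul (E i) s), Q.val_mem_invariants _⟩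

theorem nodeFunction_mul (i : Fin n) (s t : Γ(V, ⊤)) :
    Q.nodeFunction i (s * t) = Q.nodeFunction i s * Q.nodeFunction i t := by
  refine Subtype.ext ?_
  change Q.val (globalSMul (E i) (s * t)) = Q.val _ * Q.val _
  rw [globalSMul_mul, val_comp, mul_comm]

theorem nodeFunction_add (i : Fin n) (s t : Γ(V, ⊤)) :
    Q.nodeFunction i (s + t) = Q.nodeFunction i s + Q.nodeFunction i t := by
  refine Subtype.ext ?_
  change Q.val (globalSMul (E i) (s + t)) = Q.val _ + Q.val _
  rw [globalSMul_add, map_add]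

theorem nodeFunction_scalar (i : Fin n) (c : k) :
    Q.nodeFunction i (scalar k V ⊤ c) = algebraMap k Q.invariants c := by
  refine Subtype.ext ?_
  have h : globalSMul (E i) (scalar k V ⊤ c) = c • 𝟙 (E i) := (Category.id_comp _).symm
  change Q.val (globalSMul (E i) (scalar k V ⊤ c)) = algebraMap k Q.RepRing c
  rw [h, map_smul, val_id, Algebra.algebraMap_eq_smul_one]

/-- Multiplication by `s` has coordinate `s` in every frame. Each node thus provides a section of
`T`, which gives its surjectivity. -/
theorem pullback_nodeFunction [IsIntegral V] (hE : ∀ i, HasFrames (E i))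
    {T : Q.invariants →+* Γ(V, ⊤)} (hT : IsTautologicalPullback Q T) (i : Fin n) (s : Γ(V, ⊤)) :
    T (Q.nodeFunction i s) = s := by
  obtain ⟨U, m, r, hU, hr, hm⟩ := Q.exists_coordinates hE
  refine funRes_injective (le_top : U ≤ ⊤) hU ?_
  rw [Q.isTautologicalPullback_iff.mp hT U m r hr hm]
  exact evalCoord_val_globalSMul hr hm i s

/-- Where there are morphisms in both directions between two line bundles, the invariants given by
a function at the two nodes agree. -/
theorem nodeFunction_mul_eq {i j : Fin n} (f : E j ⟶ E i) (g : E i ⟶ E j) {u : Γ(V, ⊤)}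
    (hu : g ≫ f = globalSMul (E i) u) (s : Γ(V, ⊤)) :
    Q.nodeFunction i u * Q.nodeFunction j s = Q.nodeFunction i u * Q.nodeFunction i s := by
  refine Subtype.ext ?_
  change Q.val (globalSMul (E i) u) * Q.val (globalSMul (E j) s) =
    Q.val (globalSMul (E i) u) * Q.val (globalSMul (E i) s)
  -- A function commutes with `f`, so its actions at `i` and `j` agree after multiplication by `val
  -- f`; and `val f` divides the invariant of `u`.
  have h := congrArg Q.val (globalSMul_comm f s)
  rw [val_comp, val_comp] at h
  rw [← hu, val_comp, mul_assoc, mul_comm (Q.val f), h, ← mul_assoc]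

/-- If there are nonzero morphisms in both directions between the line bundles, then the pullback of
functions is an isomorphism after inverting a suitable function. -/
theorem exists_mul_eq [IsIntegral V] [Infinite k] (hE : ∀ i, HasFrames (E i)) (i : Fin n)
    (hhom : ∀ i j, ∃ f : E j ⟶ E i, f ≠ 0) {T : Q.invariants →+* Γ(V, ⊤)}
    (hT : IsTautologicalPullback Q T) :
    ∃ u : Γ(V, ⊤), u ≠ 0 ∧ ∀ b, Q.nodeFunction i u * b =
      Q.nodeFunction i u * Q.nodeFunction i (T b) := by
  have : IsDomain Γ(V, ⊤) := isDomain_sections ⟨(Classical.arbitrary V : V), trivial⟩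
  have hu : ∀ j, ∃ u : Γ(V, ⊤), u ≠ 0 ∧ ∀ s, Q.nodeFunction i u * Q.nodeFunction j s =
      Q.nodeFunction i u * Q.nodeFunction i s := by
    intro j
    obtain ⟨f, hf⟩ := hhom i j
    obtain ⟨g, hg⟩ := hhom j i
    obtain ⟨u, hu⟩ := exists_eq_globalSMul (hE i) (g ≫ f)
    refine ⟨u, ?_, Q.nodeFunction_mul_eq f g hu⟩
    -- In frames the composite is the product of the coordinates of `f` and `g` in a domain, so it
    -- vanishes only if one of them does, and then that morphism is zero.
    rintro rfl
    rw [globalSMul_zero] at hu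
    obtain ⟨U, m, r, hU, hr, hm⟩ := Q.exists_coordinates hE
    obtain ⟨a, ha⟩ := (hm j).exists_eq (g.app U (m i))
    obtain ⟨b, hb⟩ := (hm i).exists_eq (f.app U (m j))
    have h0 : (a * b) • m i = (0 : Γ(V, U)) • m i := by
      rw [mul_smul, ← hb, ← Scheme.Modules.Hom.app_smul, ← ha, zero_smul]
      exact ConcreteCategory.congr_hom (congrArg (fun ψ => Scheme.Modules.Hom.app ψ U) hu) (m i)
    have := isDomain_sections hU
    rcases mul_eq_zero.mp ((hm i).smul_inj h0) with h | h
    · exact hg (hom_ext_of_frame (hE j).torsionFree hU (hm i) (by rw [ha, h, zero_smul]; rfl))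
    · exact hf (hom_ext_of_frame (hE i).torsionFree hU (hm j) (by rw [hb, h, zero_smul]; rfl))
  choose u hu0 hu using hu
  -- The product of all `u j` is a multiple of each of them, so it serves all nodes at once.
  have hprod : ∀ (j : Fin n) s, Q.nodeFunction i (∏ j, u j) * Q.nodeFunction j s =
      Q.nodeFunction i (∏ j, u j) * Q.nodeFunction i s := fun j s => by
    rw [← Finset.mul_prod_erase _ _ (Finset.mem_univ j), nodeFunction_mul, mul_right_comm, hu,
      mul_right_comm]
  refine ⟨∏ j, u j, Finset.prod_ne_zero_iff.mpr fun j _ => hu0 j, ?_⟩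
  rintro ⟨b, hb⟩
  -- After multiplication by the chosen invariant, a generator from any node `j` becomes one from
  -- node `i`. The elements `b` for which this works form a subalgebra.
  have hb' := Q.invariants_le_loopAlgebra hb
  induction hb' using Algebra.adjoin_induction with
  | mem b hb' =>
    obtain ⟨j, f, rfl⟩ := hb'
    obtain ⟨s, rfl⟩ := exists_eq_globalSMul (hE j) f
    change _ * Q.nodeFunction j s = _ * Q.nodeFunction i (T (Q.nodeFunction j s))
    rw [Q.pullback_nodeFunction hE hT, hprod]
  | algebraMap c =>
    change _ * algebraMap k Q.invariants c = _ * Q.nodeFunction i (T (algebraMap k Q.invariants c))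
    rw [← Q.nodeFunction_scalar i, Q.pullback_nodeFunction hE hT]
  | add a b hla hlb iha ihb =>
    have ha := iha (Q.loopAlgebra_le_invariants hla)
    have hb := ihb (Q.loopAlgebra_le_invariants hlb)
    have hab : (⟨a + b, ‹_›⟩ : Q.invariants) = ⟨a, Q.loopAlgebra_le_invariants hla⟩ +
      ⟨b, Q.loopAlgebra_le_invariants hlb⟩ := rfl
    rw [hab]
    rw [T.map_add, nodeFunction_add, mul_add, mul_add, ha, hb]
  | mul a b hla hlb iha ihb =>
    have ha := iha (Q.loopAlgebra_le_invariants hla)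
    have hb := ihb (Q.loopAlgebra_le_invariants hlb)
    have hab : (⟨a * b, ‹_›⟩ : Q.invariants) = ⟨a, Q.loopAlgebra_le_invariants hla⟩ *
      ⟨b, Q.loopAlgebra_le_invariants hlb⟩ := rfl
    rw [hab]
    rw [T.map_mul, nodeFunction_mul, ← mul_assoc, ha, mul_right_comm, hb, mul_right_comm,
      mul_assoc]

end QuiverPresentation

/-! ### Ring homomorphisms that are isomorphisms after inverting an element -/

/-- Since `c` kills the kernel of the surjection `T`, the kernel disappears when `c` is inverted. -/
theorem isLocalization_away_of_mul_eq {R S : Type*} [CommRing R] [CommRing S] (T : R →+* S)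
    (hT : Function.Surjective T) (c : R) (hc : ∀ x, T x = 0 → c * x = 0) (A : Type*) [CommRing A]
    [Algebra S A] [IsLocalization.Away (T c) A] :
    letI := ((algebraMap S A).comp T).toAlgebra
    IsLocalization.Away c A := by
  let := ((algebraMap S A).comp T).toAlgebra
  have hmap : ∀ x, algebraMap R A x = algebraMap S A (T x) := fun _ => rfl
  refine (isLocalization_iff _ _).mpr ⟨?_, fun z => ?_, fun {x y} hxy => ?_⟩
  · rintro ⟨_, n, rfl⟩
    rw [hmap, map_pow, map_pow]
    exact (IsLocalization.Away.algebraMap_isUnit (T c)).pow n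
  · obtain ⟨n, a, ha⟩ := IsLocalization.Away.surj (T c) z
    obtain ⟨b, rfl⟩ := hT a
    refine ⟨⟨b, ⟨c ^ n, n, rfl⟩⟩, ?_⟩
    rw [hmap, hmap, map_pow, map_pow]
    exact ha
  · rw [hmap, hmap] at hxy
    obtain ⟨⟨_, n, rfl⟩, hn⟩ := IsLocalization.exists_of_eq (M := Submonoid.powers (T c)) hxy
    have h0 : T (c ^ n * x - c ^ n * y) = 0 := by
      rw [map_sub, map_mul, map_mul, map_pow]
      exact sub_eq_zero.mpr hn
    -- The power `n` makes the images in `S` equal; one more factor `c` kills the remaining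
    -- difference, which lies in the kernel of `T`.
    refine ⟨⟨c ^ (n + 1), n + 1, rfl⟩, ?_⟩
    have h1 := hc _ h0
    rw [mul_sub, sub_eq_zero, ← mul_assoc, ← mul_assoc, ← pow_succ'] at h1
    exact h1

/-- The open set is D(T c). Its ring is a localization of `S` and also of `R`, so it is a basic open
set of both spectra; it is dense because `S` is a domain. -/
theorem exists_dense_isOpenImmersion {R S : CommRingCat.{u}} [IsDomain S] (T : R ⟶ S)
    (hT : Function.Surjective T) (c : R) (hc0 : T c ≠ 0) (hc : ∀ x, T x = 0 → c * x = 0) :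
    ∃ U : (Spec S).Opens, Dense (U : Set (Spec S)) ∧ IsOpenImmersion (U.ι ≫ Spec.map T) := by
  let A := Localization.Away (T c)
  let j : Spec (.of A) ⟶ Spec S := Spec.map (CommRingCat.ofHom (algebraMap S A))
  have hj : IsOpenImmersion j := IsOpenImmersion.of_isLocalization (T c)
  have hjT : IsOpenImmersion (j ≫ Spec.map T) := by
    let := ((algebraMap S A).comp T.hom).toAlgebra
    have := isLocalization_away_of_mul_eq T.hom hT c hc A
    have h := IsOpenImmersion.of_isLocalization (R := R) (S := A) c
    rw [← Spec.map_comp]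
    exact h
  refine ⟨j.opensRange, ?_, ?_⟩
  · have : IrreducibleSpace (Spec S) := inferInstance
    have : Nonempty (Spec (.of A)) := by
      have : IsDomain A := IsLocalization.isDomain_of_le_nonZeroDivisors A
        (M := Submonoid.powers (T c)) (powers_le_nonZeroDivisors_of_noZeroDivisors hc0)
      exact inferInstanceAs (Nonempty (PrimeSpectrum A))
    exact j.opensRange.2.dense ⟨_, Set.mem_range_self (Classical.arbitrary (Spec (.of A)))⟩
  · have h : j.opensRange.ι ≫ Spec.map T = j.isoOpensRange.inv ≫ j ≫ Spec.map T := by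
      rw [← Category.assoc]
      congr 1
      simp
    rw [h]
    infer_instance

/-! ### The total space of a line bundle is integral -/

section

variable {X V : Scheme.{u}} {L : X.Modules} {π : V ⟶ X}
  {s : Γ((Scheme.Modules.pullback π).obj L, ⊤)}

/-- Stated for any `Φ` that sends the iterated pullback of `l` to its pullback along `f`, so that
the canonical isomorphism has to be analysed on the frame only. -/
theorem hom_pullbackSection {T : Scheme.{u}} {f : T ⟶ X} {g : T ⟶ V}
    (Φ : (Scheme.Modules.pullback g).obj ((Scheme.Modules.pullback π).obj L) ⟶
      (Scheme.Modules.pullback f).obj L)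
    {W : X.Opens} {l : Γ(L, W)} {t : Γ(V, π ⁻¹ᵁ W)}
    (ht : secRes _ le_top s = t • pullbackLocal π l) {O : T.Opens} (hO : O ≤ g ⁻¹ᵁ π ⁻¹ᵁ W)
    (hO' : O ≤ f ⁻¹ᵁ W)
    (hΦ : secRes _ hO (Φ.app _ (pullbackLocal g (pullbackLocal π l))) =
      secRes _ hO' (pullbackLocal f l)) :
    secRes _ le_top (Φ.app ⊤ (pullbackSection g s)) =
    funRes T hO (g.app (π ⁻¹ᵁ W) t) • secRes _ hO' (pullbackLocal f l) := by
  have h2 : secRes _ (le_top : g ⁻¹ᵁ π ⁻¹ᵁ W ≤ ⊤) (pullbackSection g s) =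
      g.app (π ⁻¹ᵁ W) t • pullbackLocal g (pullbackLocal π l) := by
    rw [← pullbackLocal_smul, ← ht]
    exact secRes_pullbackLocal g le_top _ s
  rw [← hom_secRes, ← secRes_secRes hO le_top, h2, hom_secRes, Scheme.Modules.Hom.app_smul,
    secRes_smul, hΦ]

theorem pullbackCongr_rfl_app {T : Scheme.{u}} {f : T ⟶ X} :
    (Scheme.Modules.pullbackCongr (rfl : f = f)).hom.app L = 𝟙 _ := by
  simp [Scheme.Modules.pullbackCongr]

theorem pullbackComp_pullbackSection {T : Scheme.{u}} {f : T ⟶ X} {g : T ⟶ V} (h : g ≫ π = f)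
    {W : X.Opens} {l : Γ(L, W)} {t : Γ(V, π ⁻¹ᵁ W)}
    (ht : secRes _ le_top s = t • pullbackLocal π l) {O : T.Opens} (hO : O ≤ g ⁻¹ᵁ π ⁻¹ᵁ W)
    (hO' : O ≤ f ⁻¹ᵁ W) :
    secRes _ le_top ((((Scheme.Modules.pullbackComp g π) ≪≫
      Scheme.Modules.pullbackCongr h).hom.app L).app ⊤ (pullbackSection g s)) =
    funRes T hO (g.app (π ⁻¹ᵁ W) t) • secRes _ hO' (pullbackLocal f l) := by
  subst h
  refine hom_pullbackSection _ ht hO hO' ?_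
  have h1 : ((Scheme.Modules.pullbackComp g π) ≪≫ Scheme.Modules.pullbackCongr rfl).hom.app L =
      (Scheme.Modules.pullbackComp g π).hom.app L := by
    rw [Iso.trans_hom, NatTrans.comp_app, pullbackCongr_rfl_app]
    exact Category.comp_id _
  refine congrArg (secRes _ hO) ?_
  refine Eq.trans ?_ (pullbackComp_pullbackLocal π g l)
  exact congrArg (fun φ => (Scheme.Modules.Hom.app φ _) (pullbackLocal g (pullbackLocal π l))) h1

/-- In the frame `l`, sections of the pullback of `L` are functions. So the part of `V` over `W` has
the universal property of the affine line over `W`, with coordinate `t`; the hypothesis `hf` says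
that `f` lands in `W`. -/
theorem IsTotalSpace.existsUnique_hom (hV : IsTotalSpace L π s) {W : X.Opens} {l : Γ(L, W)}
    (hl : IsFrame l) {t : Γ(V, π ⁻¹ᵁ W)} (ht : secRes _ le_top s = t • pullbackLocal π l)
    {T : Scheme.{u}} {f : T ⟶ X} (hf : ⊤ ≤ f ⁻¹ᵁ W) (a : Γ(T, ⊤)) :
    ∃! g : T ⟶ V, g ≫ π = f ∧ g.app (π ⁻¹ᵁ W) t = funRes T le_top a := by
  have hO : ∀ g : T ⟶ V, g ≫ π = f → ⊤ ≤ g ⁻¹ᵁ π ⁻¹ᵁ W := by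
    rintro g rfl
    exact hf
  have hfr := (hl.pullbackLocal f).restrict hf
  have key : ∀ (g : T ⟶ V) (h : g ≫ π = f),
      (((Scheme.Modules.pullbackComp g π) ≪≫ Scheme.Modules.pullbackCongr h).hom.app L).app ⊤
        (pullbackSection g s) = a • secRes _ hf (pullbackLocal f l) ↔
      g.app (π ⁻¹ᵁ W) t = funRes T le_top a := by
    intro g h
    have h1 := pullbackComp_pullbackSection h ht (hO g h) hf
    rw [secRes_rfl] at h1
    rw [h1]
    constructor
    · intro h2
      rw [← hfr.smul_inj h2, funRes_funRes, funRes_rfl]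
    · intro h2
      rw [h2, funRes_funRes, funRes_rfl]
  obtain ⟨g, ⟨hg, hg'⟩, huniq⟩ := hV T f (a • secRes _ hf (pullbackLocal f l))
  exact ⟨g, ⟨hg, (key g hg).mp hg'⟩, fun g' h => huniq g' ⟨h.1, (key g' h.1).mpr h.2⟩⟩

/-- The constant function 1 on `W` corresponds to a morphism from `W` to `V` over `X`, along which
`t` pulls back to 1. -/
theorem IsTotalSpace.ne_zero (hV : IsTotalSpace L π s) {W : X.Opens} (hW : (W : Set X).Nonempty)
    {l : Γ(L, W)} (hl : IsFrame l) {t : Γ(V, π ⁻¹ᵁ W)}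
    (ht : secRes _ le_top s = t • pullbackLocal π l) :
    t ≠ 0 ∧ ((π ⁻¹ᵁ W : V.Opens) : Set V).Nonempty := by
  obtain ⟨g, ⟨hg, hg'⟩, -⟩ := hV.existsUnique_hom hl ht (f := W.ι) (by simp) 1
  obtain ⟨p, hp⟩ := hW
  have hp' : g ⟨p, hp⟩ ∈ π ⁻¹ᵁ W := by
    have : (g ≫ π) (⟨p, hp⟩ : W.toScheme) ∈ W := by
      rw [hg]
      exact hp
    exact this
  refine ⟨?_, _, hp'⟩
  rintro rfl
  rw [map_zero, map_one] at hg'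
  have : Nonempty (g ⁻¹ᵁ π ⁻¹ᵁ W : W.toScheme.Opens) := ⟨⟨⟨p, hp⟩, hp'⟩⟩
  exact zero_ne_one hg'

/-- Comparison of universal properties: `g` is classified by the coordinate of the affine line over
`W`, and `q` by the function `t`. They are inverse to each other, and the affine line over an
integral scheme is integral. -/
theorem IsTotalSpace.isIntegral_preimage [IsIntegral X] (hV : IsTotalSpace L π s) {W : X.Opens}
    (hW : (W : Set X).Nonempty) {l : Γ(L, W)} (hl : IsFrame l) :
    IsIntegral (π ⁻¹ᵁ W).toScheme := by
  obtain ⟨t, ht⟩ := ((hl.pullbackLocal π)).exists_eq (secRes _ le_top s)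
  have hne : Nonempty W.toScheme := ⟨⟨_, hW.some_mem⟩⟩
  have hint : IsIntegral W.toScheme := isIntegral_of_isOpenImmersion W.ι
  let A := 𝔸(PUnit.{u + 1}; W.toScheme)
  let j := (π ⁻¹ᵁ W).ι
  have hf0 : ⊤ ≤ ((A ↘ W.toScheme) ≫ W.ι) ⁻¹ᵁ W := by
    intro p _
    exact ((A ↘ W.toScheme) p).2
  obtain ⟨g, ⟨hg, hgt⟩, -⟩ := hV.existsUnique_hom hl ht hf0 (AffineSpace.coord _ PUnit.unit)
  have hjW : ⊤ ≤ j ⁻¹ᵁ π ⁻¹ᵁ W := fun p _ => p.2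
  let t' : Γ((π ⁻¹ᵁ W).toScheme, ⊤) := funRes _ hjW (j.app _ t)
  let q : (π ⁻¹ᵁ W).toScheme ⟶ A := AffineSpace.homOfVector (π ∣_ W) (fun _ => t')
  have hq : q ≫ (A ↘ W.toScheme) = π ∣_ W := AffineSpace.homOfVector_over _ _
  have hqt : q.appTop (AffineSpace.coord _ PUnit.unit) = t' :=
    AffineSpace.homOfVector_appTop_coord _ _ _
  have hqg : q ≫ g = j := by
    refine (hV.existsUnique_hom hl ht (f := j ≫ π) hjW t').unique ⟨?_, ?_⟩ ⟨rfl, ?_⟩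
    · rw [Category.assoc, hg, ← Category.assoc, hq, morphismRestrict_ι]
    · rw [Scheme.Hom.comp_app]
      change q.app _ (g.app _ t) = _
      rw [hgt, ← hqt]
      exact (funRes_app q le_top le_top _).symm
    · rw [funRes_funRes, funRes_rfl]
  have hrange : Set.range g ⊆ Set.range j := by
    rintro _ ⟨p, rfl⟩
    have : g p ∈ π ⁻¹ᵁ W := by
      have : (g ≫ π) p ∈ W := by
        rw [hg]
        exact hf0 (x := p) trivial
      exact this
    simpa [j] using this
  let g' : A ⟶ (π ⁻¹ᵁ W).toScheme := IsOpenImmersion.lift j g hrange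
  have hg' : g' ≫ j = g := IsOpenImmersion.lift_fac _ _ _
  have h1 : q ≫ g' = 𝟙 _ := by
    rw [← cancel_mono j, Category.assoc, hg', hqg, Category.id_comp]
  have h2 : g' ≫ q = 𝟙 _ := by
    refine AffineSpace.hom_ext ?_ fun _ => ?_
    · rw [Category.assoc, hq, Category.id_comp, ← cancel_mono W.ι, Category.assoc,
        morphismRestrict_ι, ← Category.assoc]
      change (g' ≫ j) ≫ π = _
      rw [hg', hg]
    · rw [Scheme.Hom.comp_appTop, ConcreteCategory.comp_apply, hqt]
      -- The open sets in the types depend on the morphism, so it is made a variable for which `g' ≫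
      -- j` can be substituted.
      have key : ∀ (g₀ : A ⟶ V) (_ : g' ≫ j = g₀) (hO : ⊤ ≤ g₀ ⁻¹ᵁ π ⁻¹ᵁ W),
          g'.appTop t' = funRes A hO (g₀.app _ t) := by
        rintro _ rfl hO
        exact (funRes_app g' hjW hO (j.app _ t)).symm
      have hO : ⊤ ≤ g ⁻¹ᵁ π ⁻¹ᵁ W := fun p _ => by
        have : (g ≫ π) p ∈ W := by
          rw [hg]
          exact hf0 (x := p) trivial
        exact this
      rw [key g hg' hO, hgt]
      refine (funRes_funRes _ _ _).trans ?_
      rw [funRes_rfl]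
      rfl
  have : IsIso q := ⟨g', h1, h2⟩
  have : Nonempty (π ⁻¹ᵁ W).toScheme := by
    obtain ⟨p, hp⟩ := (hV.ne_zero hW hl ht).2
    exact ⟨⟨p, hp⟩⟩
  exact isIntegral_of_isOpenImmersion q

/-- Reducedness is checked on stalks. For irreducibility, the pieces over frames of `L` are
irreducible, and any two of them meet because `X` is irreducible and the preimage of a nonempty open
set with a frame is nonempty. -/
theorem IsTotalSpace.isIntegral [IsIntegral X] (hV : IsTotalSpace L π s) (hL : HasFrames L) :
    IsIntegral V := by
  have hpt : ∀ p : V, ∃ W : X.Opens, p ∈ π ⁻¹ᵁ W ∧ (W : Set X).Nonempty ∧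
      ∃ l : Γ(L, W), IsFrame l := fun p => by
    obtain ⟨W, l, hp, hl⟩ := hL (π p)
    exact ⟨W, hp, ⟨_, hp⟩, l, hl⟩
  choose W hpW hW l hl using hpt
  have hred : IsReduced V := by
    have : ∀ p, _root_.IsReduced (V.presheaf.stalk p) := fun p => by
      have := hV.isIntegral_preimage (hW p) (hl p)
      let y : (π ⁻¹ᵁ W p).toScheme := ⟨p, hpW p⟩
      have := isReduced_stalk_of_isReduced (π ⁻¹ᵁ W p).toScheme y
      let e := (π ⁻¹ᵁ W p).stalkIso y
      exact isReduced_of_injective e.inv.hom (ConcreteCategory.injective_of_mono_of_preservesPullback e.inv)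
    exact isReduced_of_isReduced_stalk V
  have hirr : IrreducibleSpace V := by
    have hpre : IsPreirreducible (Set.univ : Set V) := by
      rintro A B hA hB ⟨a, -, ha⟩ ⟨b, -, hb⟩
      have irr : ∀ p, IsPreirreducible ((π ⁻¹ᵁ W p : V.Opens) : Set V) := fun p => by
        have := hV.isIntegral_preimage (hW p) (hl p)
        have h := (PreirreducibleSpace.isPreirreducible_univ (X := (π ⁻¹ᵁ W p).toScheme)).image
          (π ⁻¹ᵁ W p).ι (π ⁻¹ᵁ W p).ι.continuous.continuousOn
        rw [Set.image_univ, Scheme.Opens.range_ι] at h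
        exact h
      obtain ⟨x, hx⟩ := inter_nonempty (hW a) (hW b)
      have hab : (W a ⊓ W b : X.Opens) ≤ W a := inf_le_left
      have hl' := (hl a).restrict hab
      obtain ⟨t, ht⟩ := (hl'.pullbackLocal π).exists_eq (secRes _ le_top s)
      obtain ⟨z, hz⟩ := (hV.ne_zero ⟨x, hx⟩ hl' ht).2
      -- In the piece around `a`, the set `A` meets the piece around `b`; inside the latter, `A`
      -- then meets `B`.
      obtain ⟨y, hy, hyA, hyb⟩ := irr a A _ hA (π ⁻¹ᵁ W b).isOpen ⟨a, hpW a, ha⟩ ⟨z, hz.1, hz.2⟩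
      obtain ⟨w, hw, hwA, hwB⟩ := irr b A B hA hB ⟨y, hyb, hyA⟩ ⟨b, hpW b, hb⟩
      exact ⟨w, trivial, hwA, hwB⟩
    have hne : Nonempty V := by
      obtain ⟨x⟩ := (inferInstance : Nonempty X)
      obtain ⟨W', l', hx, hl'⟩ := hL x
      obtain ⟨t, ht⟩ := (hl'.pullbackLocal π).exists_eq (secRes _ le_top s)
      obtain ⟨z, -⟩ := (hV.ne_zero ⟨x, hx⟩ hl' ht).2
      exact ⟨z⟩
    exact { isPreirreducible_univ := hpre, toNonempty := hne }
  exact isIntegral_of_irreducibleSpace_of_isReduced V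

end

/-! ### Modules with local frames are coherent -/

section

variable {X : Scheme.{u}} {M : X.Modules}

theorem isIso_of_bijective_app {C : Type u} [Category.{u} C] {J : GrothendieckTopology C}
    {R : Sheaf J RingCat.{u}} {M N : SheafOfModules.{u} R} (f : M ⟶ N)
    (h : ∀ U, Function.Bijective (f.val.app U)) : IsIso f := by
  have h1 : IsIso ((SheafOfModules.forget R ⋙ PresheafOfModules.toPresheaf _).map f) := by
    rw [NatTrans.isIso_iff_isIso_app]
    intro U
    exact (ConcreteCategory.isIso_iff_bijective _).mpr (h U)
  exact isIso_of_reflects_iso f (SheafOfModules.forget R ⋙ PresheafOfModules.toPresheaf _)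

/-- A section over `U`, as a global section of the restriction of the sheaf to `U`. -/
def overSection {U : X.Opens} (m : Γ(M, U)) :
    (SheafOfModules.over (R := X.ringCatSheaf) M U).sections :=
  PresheafOfModules.sectionsMk (M := (SheafOfModules.over (R := X.ringCatSheaf) M U).val)
    (fun W => secRes M W.unop.hom.le m) (fun W T f => by
      exact secRes_secRes f.unop.left.le W.unop.hom.le m)

theorem IsFrame.isIso_unitHomEquiv_symm {U : X.Opens} {m : Γ(M, U)} (hm : IsFrame m) :
    IsIso ((SheafOfModules.over (R := X.ringCatSheaf) M U).unitHomEquiv.symm (overSection m)) := by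
  refine isIso_of_bijective_app _ fun W => ?_
  exact hm W.unop.left W.unop.hom.le

/-- The free module on one generator is the unit. Presentations are phrased with free modules,
frames with the unit. -/
theorem isIso_freeHomEquiv_symm {C : Type u} [Category.{u} C] {J : GrothendieckTopology C}
    {R : Sheaf J RingCat.{u}} [HasWeakSheafify J AddCommGrpCat.{u}]
    [J.WEqualsLocallyBijective AddCommGrpCat.{u}] {M : SheafOfModules.{u} R} (s : M.sections)
    (h : IsIso (M.unitHomEquiv.symm s)) :
    IsIso (M.freeHomEquiv.symm fun _ : PUnit.{u + 1} => s) := by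
  have hι : ∀ i : PUnit.{u + 1}, SheafOfModules.ιFree i ≫
      M.freeHomEquiv.symm (fun _ : PUnit.{u + 1} => s) = M.unitHomEquiv.symm s := fun i => by
    rw [← SheafOfModules.unitHomEquiv_symm_freeHomEquiv_apply, Equiv.apply_symm_apply]
  refine ⟨inv (M.unitHomEquiv.symm s) ≫ SheafOfModules.ιFree PUnit.unit, ?_, ?_⟩
  · refine Limits.Cofan.IsColimit.hom_ext (SheafOfModules.isColimitFreeCofan _) _ _ fun i => ?_
    change SheafOfModules.ιFree i ≫ (M.freeHomEquiv.symm (fun _ : PUnit.{u + 1} => s) ≫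
      inv (M.unitHomEquiv.symm s) ≫ SheafOfModules.ιFree PUnit.unit) =
      SheafOfModules.ιFree i ≫ 𝟙 (SheafOfModules.free PUnit)
    rw [Category.comp_id, ← Category.assoc, hι, IsIso.hom_inv_id_assoc]
  · rw [Category.assoc, hι, IsIso.inv_hom_id]

/-- A sheaf of modules that is locally free of rank one is of finite presentation. -/
theorem isFinitePresentation_of_isIso_unitHomEquiv {C : Type u} [Category.{u} C]
    {J : GrothendieckTopology C} {R : Sheaf J RingCat.{u}}
    [∀ X, HasSheafify (J.over X) AddCommGrpCat.{u}]
    [∀ X, (J.over X).WEqualsLocallyBijective AddCommGrpCat.{u}] {M : SheafOfModules.{u} R}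
    {ι : Type u} {U : ι → C} (hU : J.CoversTop U) (s : ∀ i, (M.over (U i)).sections)
    (hs : ∀ i, IsIso ((M.over (U i)).unitHomEquiv.symm (s i))) : M.IsFinitePresentation := by
  have hiso := fun i => isIso_freeHomEquiv_symm (s i) (hs i)
  let q : SheafOfModules.LocalGeneratorsData.{u} M :=
    { I := ι
      X := U
      coversTop := hU
      generators := fun i =>
        { I := PUnit
          s := fun _ => s i
          epi := by
            have := hiso i
            infer_instance } }
  have : q.IsLocallyFreeData := ⟨hiso⟩
  -- One generator and no relations on each piece.
  exact ⟨q.quasiCoherentData, ⟨fun p => ⟨⟨inferInstanceAs (Finite PUnit)⟩,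
    ⟨inferInstanceAs (Finite (ULift Empty))⟩⟩⟩⟩

theorem HasFrames.isCoherentModule (hM : HasFrames M) : IsCoherentModule M := by
  choose U m hp hm using hM
  have hU : TopologicalSpace.IsOpenCover U :=
    TopologicalSpace.Opens.ext (Set.eq_univ_of_forall fun p => by
      simpa using ⟨p, hp p⟩)
  exact isFinitePresentation_of_isIso_unitHomEquiv (R := X.ringCatSheaf) (M := M)
    ((Opens.coversTop_iff _ U).mpr hU) (fun p => overSection (m p))
    (fun p => (hm p).isIso_unitHomEquiv_symm)

end

/-! ### Subsheaves -/

section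

variable {X : Scheme.{u}}

/-- A local condition on sections, closed under linear combinations, defines a subsheaf. -/
theorem exists_subsheaf (K : X.Modules) (P : ∀ U : X.Opens, Γ(K, U) → Prop)
    (hzero : ∀ U, P U 0) (hadd : ∀ U x y, P U x → P U y → P U (x + y))
    (hsmul : ∀ U (r : Γ(X, U)) x, P U x → P U (r • x))
    (hres : ∀ (W U : X.Opens) (h : W ≤ U) x, P U x → P W (secRes K h x))
    (hloc : ∀ (U : X.Opens) (x : Γ(K, U)),
      (∀ p ∈ U, ∃ (W : X.Opens) (h : W ≤ U), p ∈ W ∧ P W (secRes K h x)) → P U x) :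
    ∃ (H : X.Modules) (i : H ⟶ K), (∀ U, Function.Injective (i.app U)) ∧
      ∀ U y, (∃ h, i.app U h = y) ↔ P U y := by
  let S : PresheafOfModules.Submodule K.val :=
    { obj := fun U =>
        { carrier := {x : Γ(K, U.unop) | P U.unop x}
          zero_mem' := hzero _
          add_mem' := fun {x y} hx hy => hadd _ x y hx hy
          smul_mem' := fun r x hx => hsmul U.unop r x hx }
      map := fun {U W} f x hx => hres _ _ f.unop.le x hx }
  have hS : TopCat.Presheaf.IsSheaf S.toPresheafOfModules.presheaf := by
    refine (TopCat.Presheaf.isSheaf_iff_isSheafUniqueGluing _).mpr fun ι U sf hsf => ?_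
    -- Sections are glued in `K`; the locality of `P` puts the result into the subsheaf.
    have hcompat : TopCat.Presheaf.IsCompatible K.presheaf U (fun i => (sf i).1) :=
      fun i j => congrArg Subtype.val (hsf i j)
    obtain ⟨s, hs, hu⟩ := TopCat.Sheaf.existsUnique_gluing ⟨K.presheaf, K.isSheaf⟩ U _ hcompat
    refine ⟨⟨s, hloc _ s fun p hp => ?_⟩, fun i => Subtype.ext (hs i),
      fun t ht => Subtype.ext (hu t.1 fun i => congrArg Subtype.val (ht i))⟩
    obtain ⟨i, hi⟩ := TopologicalSpace.Opens.mem_iSup.mp hp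
    refine ⟨U i, le_iSup U i, hi, ?_⟩
    have h := hs i
    change secRes K _ s = (sf i).1 at h
    rw [h]
    exact (sf i).2
  let H : X.Modules := ⟨S.toPresheafOfModules, hS⟩
  let i : H ⟶ K := ⟨S.ι⟩
  refine ⟨H, i, fun U => Subtype.val_injective, fun U y => ⟨?_, fun hy => ⟨⟨y, hy⟩, rfl⟩⟩⟩
  rintro ⟨h, rfl⟩
  exact h.2

theorem secRes_openPart_injective [IsIntegral X] {M : X.Modules} (hM : TorsionFree M)
    {U₀ : X.Opens} (hU₀ : (U₀ : Set X).Nonempty) (W : X.Opens) :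
    Function.Injective (secRes M (openPart_le_right U₀ W)) := by
  intro z z' h
  rcases Set.eq_empty_or_nonempty (W : Set X) with hW | hW
  · refine sec_ext fun p hp => ?_
    exact absurd (show p ∈ (W : Set X) from hp) (by simp [hW])
  · obtain ⟨p, hp⟩ := inter_nonempty hU₀ hW
    exact hM _ _ _ ⟨p, le_openPart inf_le_left inf_le_right hp⟩ h

theorem torsionFree_structureModule [IsIntegral X] : TorsionFree (structureModule X) :=
  HasFrames.torsionFree fun _ => ⟨⊤, _, trivial, isFrame_one ⊤⟩

theorem funRes_openPart_injective [IsIntegral X] {U₀ : X.Opens} (hU₀ : (U₀ : Set X).Nonempty)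
    (W : X.Opens) : Function.Injective (funRes X (openPart_le_right U₀ W)) :=
  secRes_openPart_injective torsionFree_structureModule hU₀ W

/-- A section over `W ∩ U₀` extends to `W` when it does so locally. -/
theorem exists_extension_openPart [IsIntegral X] {N : X.Modules} (hN : TorsionFree N)
    {U₀ : X.Opens} (hU₀ : (U₀ : Set X).Nonempty) {W : X.Opens} (y : Γ(N, openPart U₀ W))
    (h : ∀ p ∈ W, ∃ (T : X.Opens) (hT : T ≤ W), p ∈ T ∧ ∃ z : Γ(N, T),
      secRes N (openPart_le_right U₀ T) z = secRes N (openPart_mono U₀ hT) y) :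
    ∃ z : Γ(N, W), secRes N (openPart_le_right U₀ W) z = y := by
  obtain ⟨z, hz⟩ := exists_glue (M := N) (U := W)
    (fun T z => ∃ hT : T ≤ W, secRes N (openPart_le_right U₀ T) z =
      secRes N (openPart_mono U₀ hT) y)
    (by
      rintro T T' h' z ⟨hT, hz⟩
      refine ⟨h'.trans hT, ?_⟩
      have := congrArg (secRes N (openPart_mono U₀ h')) hz
      rwa [secRes_secRes, secRes_secRes, ← secRes_secRes (openPart_le_right U₀ T) h'] at this)
    (by
      rintro T z z' ⟨hT, hz⟩ ⟨hT', hz'⟩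
      exact secRes_openPart_injective hN hU₀ T (hz.trans hz'.symm))
    (by
      intro p hp
      obtain ⟨T, hT, hpT, z, hz⟩ := h p hp
      exact ⟨T, hT, hpT, z, hT, hz⟩)
  refine ⟨z, sec_ext fun p hp => ?_⟩
  obtain ⟨T, hT, hpT, hT', hzT⟩ := hz p (openPart_le_right U₀ W hp)
  refine ⟨openPart U₀ T, openPart_mono U₀ hT,
    le_openPart (T := U₀ ⊓ T) inf_le_left inf_le_right ⟨openPart_le_left U₀ W hp, hpT⟩, ?_⟩
  rw [← hzT, secRes_secRes, secRes_secRes]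

/-! ### The sheaf of morphisms, embedded by the image of a frame. -/

variable {M N : X.Modules} {U₀ : X.Opens} {m : Γ(M, U₀)}

/-- The section `y` of `N` over `U ∩ U₀` is the image of the frame `m` of `M` over `U₀` under a
morphism from `M` to `N` over `U`. -/
def IsFrameImage (hm : IsFrame m) (U : X.Opens) (y : Γ(openExtension N U₀, U)) : Prop :=
  ∀ (W : X.Opens) (h : W ≤ U) (x : Γ(M, W)), ∃ z : Γ(N, W),
    secRes N (openPart_le_right U₀ W) z =
      localCoord hm x • secRes N (openPart_mono U₀ h) (ofExtend y)

/-- Every section of `M` over a smaller open set is a multiple `r` of `e`, so `r` times the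
restriction of `z` is the required extension. -/
theorem isFrameImage_of_frame (hm : IsFrame m) {U : X.Opens} {y : Γ(openExtension N U₀, U)}
    {e : Γ(M, U)} (he : IsFrame e) {z : Γ(N, U)}
    (hz : secRes N (openPart_le_right U₀ U) z = localCoord hm e • ofExtend y) :
    IsFrameImage hm U y := by
  intro W h x
  obtain ⟨r, rfl⟩ := (he.restrict h).exists_eq x
  refine ⟨r • secRes N h z, ?_⟩
  have h1 := congrArg (secRes N (openPart_mono U₀ h)) hz
  rw [secRes_secRes, secRes_smul] at h1
  rw [localCoord_smul_left, localCoord_secRes, secRes_smul, secRes_secRes, h1, mul_smul]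

variable [IsIntegral X]

theorem isFrameImage_of_local (hm : IsFrame m) (hN : TorsionFree N)
    (hU₀ : (U₀ : Set X).Nonempty) {U : X.Opens} {y : Γ(openExtension N U₀, U)}
    (hy : ∀ p ∈ U, ∃ (W : X.Opens) (h : W ≤ U), p ∈ W ∧ IsFrameImage hm W (secRes _ h y)) :
    IsFrameImage hm U y := by
  intro W h x
  refine exists_extension_openPart hN hU₀ _ fun p hp => ?_
  obtain ⟨T, hT, hpT, hyT⟩ := hy p (h hp)
  obtain ⟨z, hz⟩ := hyT (T ⊓ W) inf_le_left (secRes M inf_le_right x)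
  refine ⟨T ⊓ W, inf_le_right, ⟨hpT, hp⟩, z, ?_⟩
  rw [hz, localCoord_secRes, secRes_ofExtend, secRes_secRes, secRes_smul, secRes_secRes]

/-- A morphism to a torsion-free module is determined by the image of the frame `m`. The sheaf of
morphisms can therefore be realised as the subsheaf of those images on U₀ for which the resulting
map extends. -/
theorem exists_homSheaf (hm : IsFrame m) (hN : TorsionFree N) (hU₀ : (U₀ : Set X).Nonempty) :
    ∃ (H : X.Modules) (i : H ⟶ openExtension N U₀), (∀ U, Function.Injective (i.app U)) ∧
      ∀ U y, (∃ h, i.app U h = y) ↔ IsFrameImage hm U y := by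
  refine exists_subsheaf _ _ ?_ ?_ ?_ ?_ ?_
  · intro U W h x
    exact ⟨0, by rw [ofExtend_zero, map_zero, map_zero, smul_zero]⟩
  · intro U y y' hy hy' W h x
    obtain ⟨z, hz⟩ := hy W h x
    obtain ⟨z', hz'⟩ := hy' W h x
    exact ⟨z + z', by rw [ofExtend_add, map_add, map_add, smul_add, hz, hz']⟩
  · intro U r y hy W h x
    obtain ⟨z, hz⟩ := hy W h x
    refine ⟨funRes X h r • z, ?_⟩
    rw [ofExtend_smul, secRes_smul, secRes_smul, hz, smul_comm, funRes_funRes, funRes_funRes]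
  · intro W U h y hy T h' x
    obtain ⟨z, hz⟩ := hy T (h'.trans h) x
    exact ⟨z, by rw [hz, secRes_ofExtend, secRes_secRes]⟩
  · exact fun U y hy => isFrameImage_of_local hm hN hU₀ hy

/-- The sheaf of morphisms from `M` to `N`, given by the images of a frame of `M`. -/
def homSheaf (hm : IsFrame m) (hN : TorsionFree N) (hU₀ : (U₀ : Set X).Nonempty) : X.Modules :=
  (exists_homSheaf hm hN hU₀).choose

/-- The image of the frame. -/
def frameImage (hm : IsFrame m) (hN : TorsionFree N) (hU₀ : (U₀ : Set X).Nonempty) :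
    homSheaf hm hN hU₀ ⟶ openExtension N U₀ :=
  (exists_homSheaf hm hN hU₀).choose_spec.choose

variable (hm : IsFrame m) (hN : TorsionFree N) (hU₀ : (U₀ : Set X).Nonempty)

theorem frameImage_injective (U : X.Opens) :
    Function.Injective ((frameImage hm hN hU₀).app U) :=
  (exists_homSheaf hm hN hU₀).choose_spec.choose_spec.1 U

theorem exists_frameImage_eq_iff {U : X.Opens} (y : Γ(openExtension N U₀, U)) :
    (∃ h, (frameImage hm hN hU₀).app U h = y) ↔ IsFrameImage hm U y :=
  (exists_homSheaf hm hN hU₀).choose_spec.choose_spec.2 U y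

theorem isFrameImage_frameImage {U : X.Opens} (h : Γ(homSheaf hm hN hU₀, U)) :
    IsFrameImage hm U ((frameImage hm hN hU₀).app U h) :=
  (exists_frameImage_eq_iff hm hN hU₀ _).mp ⟨h, rfl⟩

/-- If `e` and `e'` are local frames of `M` and `N`, the morphism sending `e` to `e'` is a frame. As
`m = b • e`, it is represented by `b • e'`. -/
theorem hasFrames_homSheaf (hM : HasFrames M) (hN' : HasFrames N) :
    HasFrames (homSheaf hm hN hU₀) := by
  intro p
  obtain ⟨U₁, e₁, hp₁, he₁⟩ := hM p
  obtain ⟨U, e', hp, hU, he'⟩ := hN'.exists_le hp₁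
  have he := he₁.restrict hU
  set e := secRes M hU e₁
  have heO := he.restrict (openPart_le_right U₀ U)
  have hmO := hm.restrict (openPart_le_left U₀ U)
  obtain ⟨b, hb⟩ := heO.exists_eq (secRes M (openPart_le_left U₀ U) m)
  -- `e` and `m` are both frames over the part of `U` in U₀, so the two transition functions are
  -- inverse to each other.
  have hab : localCoord hm e * b = 1 := by
    refine heO.smul_inj ?_
    rw [one_smul, mul_smul, ← hb, localCoord_smul]
  have hy : IsFrameImage hm U (toExtend (b • secRes N (openPart_le_right U₀ U) e')) := by
    refine isFrameImage_of_frame hm he (z := e') ?_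
    rw [ofExtend_toExtend, smul_smul, hab, one_smul]
  obtain ⟨h, hh⟩ := (exists_frameImage_eq_iff hm hN hU₀ _).mpr hy
  refine ⟨U, h, hp, ?_⟩
  intro W hW
  change Function.Bijective fun r : Γ(X, W) => r • secRes _ hW h
  have hval : ∀ r : Γ(X, W), ofExtend ((frameImage hm hN hU₀).app W (r • secRes _ hW h)) =
      (funRes X (openPart_le_right U₀ W) r * funRes X (openPart_mono U₀ hW) b) •
        secRes N ((openPart_le_right U₀ W).trans hW) e' := by
    intro r
    rw [Scheme.Modules.Hom.app_smul, hom_secRes, hh, ofExtend_smul, secRes_ofExtend,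
      ofExtend_toExtend, secRes_smul, secRes_secRes, mul_smul]
  have he'' := he'.restrict ((openPart_le_right U₀ W).trans hW)
  have hbW : funRes X (openPart_mono U₀ hW) (localCoord hm e) *
      funRes X (openPart_mono U₀ hW) b = 1 := by
    rw [← map_mul, hab, map_one]
  constructor
  · intro r r' hr
    have h1 := congrArg (fun z => ofExtend ((frameImage hm hN hU₀).app W z)) hr
    simp only [hval] at h1
    have h2 := he''.smul_inj h1
    refine funRes_openPart_injective hU₀ W ?_
    have h3 := congrArg (fun z => funRes X (openPart_mono U₀ hW) (localCoord hm e) * z) h2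
    rwa [mul_left_comm, hbW, mul_one, mul_left_comm, hbW, mul_one] at h3
  · intro g
    obtain ⟨z, hz⟩ := isFrameImage_frameImage hm hN hU₀ g W le_rfl (secRes M hW e)
    obtain ⟨r, rfl⟩ := (he'.restrict hW).exists_eq z
    refine ⟨r, frameImage_injective hm hN hU₀ W (ofExtend_injective ?_)⟩
    rw [secRes_smul, secRes_secRes, secRes_rfl, localCoord_secRes] at hz
    simp only [hval]
    rw [mul_comm, mul_smul, hz, smul_smul, mul_comm, hbW, one_smul]

/-- A global section of the sheaf of morphisms gives a morphism. -/
theorem exists_hom_of_frameImage (h : Γ(homSheaf hm hN hU₀, ⊤)) :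
    ∃ φ : M ⟶ N, ∀ (W : X.Opens) (x : Γ(M, W)),
      secRes N (openPart_le_right U₀ W) (φ.app W x) = localCoord hm x •
        secRes N (openPart_mono U₀ le_top) (ofExtend ((frameImage hm hN hU₀).app ⊤ h)) := by
  have hex := fun W => isFrameImage_frameImage hm hN hU₀ h W le_top
  choose z hz using hex
  refine ⟨modulesHomMk (fun W => AddMonoidHom.mk' (z W) fun x y => ?_) (fun W r x => ?_)
    (fun W T hWT x => ?_), hz⟩
  · refine secRes_openPart_injective hN hU₀ W ?_
    rw [map_add, hz, hz, hz, localCoord_add, add_smul]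
  · refine secRes_openPart_injective hN hU₀ W ?_
    change secRes N _ (z W (r • x)) = secRes N _ (r • z W x)
    rw [secRes_smul, hz, hz, localCoord_smul_left, mul_smul]
  · refine secRes_openPart_injective hN hU₀ W ?_
    change secRes N _ (z W (secRes M hWT x)) = secRes N _ (secRes N hWT (z T x))
    rw [hz, localCoord_secRes, secRes_secRes,
      ← secRes_secRes (openPart_mono U₀ hWT) (openPart_le_right U₀ T), hz, secRes_smul,
      secRes_secRes]

/-- The value at `m` of the morphism given by `h` is the frame image of `h`, and frame images
determine sections. -/
theorem exists_hom_ne_zero {h : Γ(homSheaf hm hN hU₀, ⊤)} (hh : h ≠ 0) : ∃ φ : M ⟶ N, φ ≠ 0 := by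
  obtain ⟨φ, hφ⟩ := exists_hom_of_frameImage hm hN hU₀ h
  refine ⟨φ, ?_⟩
  rintro rfl
  refine hh (frameImage_injective hm hN hU₀ ⊤ (ofExtend_injective ?_))
  have h1 := hφ U₀ m
  have h2 : localCoord hm m = 1 := IsFrame.coord_eq _ (one_smul _ _).symm
  rw [h2, one_smul] at h1
  have h3 : openPart U₀ ⊤ ≤ openPart U₀ U₀ :=
    le_openPart (openPart_le_left _ _) (openPart_le_left _ _)
  have h4 := congrArg (secRes N h3) h1
  rw [secRes_secRes, secRes_secRes, secRes_rfl] at h4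
  rw [← h4, map_zero, ofExtend_zero]
  exact map_zero _

end

/-! ### Sections of tensor products -/

section

variable {X : Scheme.{u}} {M N P : X.Modules}

/-- The presheaf tensor product. -/
abbrev presheafTensor (M N : X.Modules) : PresheafOfModules X.ringCatSheaf.obj :=
  PresheafOfModules.Monoidal.tensorObj (R := X.presheaf) M.val N.val

open scoped TensorProduct in
/-- The sections of the tensor product given by tensors. -/
def tensorSecHom (M N : X.Modules) (U : X.Opens) :
    Γ(M, U) ⊗[Γ(X, U)] Γ(N, U) →+ Γ(sheafTensor M N, U) :=
  ((CategoryTheory.toSheafify (Opens.grothendieckTopology X)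
    (presheafTensor M N).presheaf).app (.op U)).hom

/-- The section `x ⊗ y`. -/
def tensorSec {U : X.Opens} (x : Γ(M, U)) (y : Γ(N, U)) : Γ(sheafTensor M N, U) :=
  tensorSecHom M N U (TensorProduct.tmul Γ(X, U) x y)

theorem tensorSec_add_right {U : X.Opens} (x : Γ(M, U)) (y y' : Γ(N, U)) :
    tensorSec x (y + y') = tensorSec x y + tensorSec x y' := by
  rw [tensorSec, TensorProduct.tmul_add, map_add]
  rfl

/-- The unit of sheafification, at a tensor product. -/
def presheafTensorUnit (M N : X.Modules) :
    presheafTensor M N ⟶ (PresheafOfModules.restrictScalars (𝟙 X.ringCatSheaf.obj)).obj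
      ((SheafOfModules.forget _).obj (sheafTensor M N)) :=
  PresheafOfModules.sheafificationHomEquiv (𝟙 X.ringCatSheaf.obj) (𝟙 (sheafTensor M N))

theorem tensorSec_smul_left {U : X.Opens} (r : Γ(X, U)) (x : Γ(M, U)) (y : Γ(N, U)) :
    tensorSec (r • x) y = r • tensorSec x y :=
  LinearMap.map_smul ((presheafTensorUnit M N).app (.op U)).hom r (TensorProduct.tmul Γ(X, U) x y)

theorem tensorSec_smul_right {U : X.Opens} (r : Γ(X, U)) (x : Γ(M, U)) (y : Γ(N, U)) :
    tensorSec x (r • y) = r • tensorSec x y := by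
  rw [← tensorSec_smul_left, tensorSec, tensorSec, TensorProduct.smul_tmul]

theorem secRes_tensorSec {W U : X.Opens} (h : W ≤ U) (x : Γ(M, U)) (y : Γ(N, U)) :
    secRes (sheafTensor M N) h (tensorSec x y) = tensorSec (secRes M h x) (secRes N h y) :=
  (ConcreteCategory.congr_hom ((CategoryTheory.toSheafify (Opens.grothendieckTopology X)
    (presheafTensor M N).presheaf).naturality (homOfLE h).op)
      (TensorProduct.tmul Γ(X, U) x y)).symm

theorem tensor_hom_ext {f g : sheafTensor M N ⟶ P}
    (h : ∀ (U : X.Opens) (x : Γ(M, U)) (y : Γ(N, U)),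
      f.app U (tensorSec x y) = g.app U (tensorSec x y)) : f = g := by
  refine (PresheafOfModules.sheafificationHomEquiv (𝟙 X.ringCatSheaf.obj)).injective ?_
  refine PresheafOfModules.hom_ext fun U => ?_
  refine ModuleCat.MonoidalCategory.tensor_ext (R := X.presheaf.obj U) fun x y => ?_
  exact h U.unop x y

/-- Bilinear maps give morphisms from the tensor product. -/
theorem exists_tensor_hom (b : ∀ U : X.Opens, Γ(M, U) → Γ(N, U) → Γ(P, U))
    (hadd : ∀ U x x' y, b U (x + x') y = b U x y + b U x' y)
    (hsmul : ∀ U (r : Γ(X, U)) x y, b U (r • x) y = r • b U x y)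
    (hadd' : ∀ U x y y', b U x (y + y') = b U x y + b U x y')
    (hsmul' : ∀ U (r : Γ(X, U)) x y, b U x (r • y) = r • b U x y)
    (hres : ∀ (W U : X.Opens) (h : W ≤ U) x y,
      b W (secRes M h x) (secRes N h y) = secRes P h (b U x y)) :
    ∃ φ : sheafTensor M N ⟶ P, ∀ (U : X.Opens) (x : Γ(M, U)) (y : Γ(N, U)),
      φ.app U (tensorSec x y) = b U x y := by
  let ψ : presheafTensor M N ⟶ (PresheafOfModules.restrictScalars (𝟙 X.ringCatSheaf.obj)).obj
      ((SheafOfModules.forget _).obj P) :=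
    { app := fun U => ModuleCat.MonoidalCategory.tensorLift (R := X.presheaf.obj U)
        (M₁ := M.val.obj U) (M₂ := N.val.obj U) (M₃ := P.val.obj U) (b U.unop)
        (hadd U.unop) (hsmul U.unop) (hadd' U.unop) (hsmul' U.unop)
      naturality := fun {U W} i => by
        refine ModuleCat.MonoidalCategory.tensor_ext (R := X.presheaf.obj U) fun x y => ?_
        exact hres W.unop U.unop i.unop.le x y }
  refine ⟨(PresheafOfModules.sheafificationHomEquiv (𝟙 X.ringCatSheaf.obj)).symm ψ, ?_⟩
  intro U x y
  have h := (PresheafOfModules.sheafificationHomEquiv (𝟙 X.ringCatSheaf.obj)).apply_symm_apply ψ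
  have h2 := congrArg (fun f => PresheafOfModules.Hom.app f (.op U)) h
  exact ConcreteCategory.congr_hom h2 (TensorProduct.tmul Γ(X, U) x y)

end

/-! ### Morphisms to a pushforward -/

section

variable {X V : Scheme.{u}} {π : V ⟶ X} {K : X.Modules} {P : V.Modules}

/-- The value of a morphism to a pushforward, as a section over the preimage. -/
def pushSec (φ : K ⟶ (Scheme.Modules.pushforward π).obj P) {W : X.Opens} (x : Γ(K, W)) :
    Γ(P, π ⁻¹ᵁ W) := φ.app W x

theorem pushSec_add (φ : K ⟶ (Scheme.Modules.pushforward π).obj P) {W : X.Opens} (x y : Γ(K, W)) :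
    pushSec φ (x + y) = pushSec φ x + pushSec φ y := map_add (φ.app W).hom x y

theorem pushSec_smul (φ : K ⟶ (Scheme.Modules.pushforward π).obj P) {W : X.Opens} (r : Γ(X, W))
    (x : Γ(K, W)) : pushSec φ (r • x) = π.app W r • pushSec φ x :=
  Scheme.Modules.Hom.app_smul φ r x

theorem secRes_pushSec (φ : K ⟶ (Scheme.Modules.pushforward π).obj P) {W T : X.Opens} (h : W ≤ T)
    (x : Γ(K, T)) : secRes P (π.preimage_mono h) (pushSec φ x) = pushSec φ (secRes K h x) :=
  (hom_secRes φ h x).symm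

/-- Values need be prescribed over `A` only, provided that they extend locally. Extensions are
unique, hence they glue and inherit linearity and compatibility with restriction. -/
theorem exists_pushforward_hom [IsIntegral V] (hP : TorsionFree P) {A : V.Opens}
    (hA : (A : Set V).Nonempty) (g : ∀ W : X.Opens, Γ(K, W) → Γ(P, openPart A (π ⁻¹ᵁ W)))
    (hadd : ∀ W (x y : Γ(K, W)), g W (x + y) = g W x + g W y)
    (hsmul : ∀ W (r : Γ(X, W)) (x : Γ(K, W)), g W (r • x) =
      funRes V (openPart_le_right A (π ⁻¹ᵁ W)) (π.app W r) • g W x)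
    (hres : ∀ (W T : X.Opens) (h : W ≤ T) (x : Γ(K, T)),
      g W (secRes K h x) = secRes P (openPart_mono A (π.preimage_mono h)) (g T x))
    (hext : ∀ W (x : Γ(K, W)), ∀ p ∈ π ⁻¹ᵁ W, ∃ (T : V.Opens) (hT : T ≤ π ⁻¹ᵁ W), p ∈ T ∧
      ∃ z : Γ(P, T), secRes P (openPart_le_right A T) z = secRes P (openPart_mono A hT) (g W x)) :
    ∃ ψ : K ⟶ (Scheme.Modules.pushforward π).obj P, ∀ W (x : Γ(K, W)),
      secRes P (openPart_le_right A (π ⁻¹ᵁ W)) (pushSec ψ x) = g W x := by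
  choose z hz using fun W x => exists_extension_openPart hP hA (g W x) (hext W x)
  refine ⟨homToPushforward π z (fun W x y => ?_) (fun W r x => ?_) (fun W T h x => ?_), hz⟩
  · refine secRes_openPart_injective hP hA _ ?_
    rw [map_add, hz, hz, hz, hadd]
  · refine secRes_openPart_injective hP hA _ ?_
    rw [secRes_smul, hz, hz, hsmul]
  · refine secRes_openPart_injective hP hA _ ?_
    rw [hz, secRes_secRes, hres, ← hz T, secRes_secRes]

end

/-! ### Pairings -/

section

variable {X : Scheme.{u}} {L N : X.Modules}

/-- The value of a pairing. -/
def pairing (e : sheafTensor L N ⟶ structureModule X) {U : X.Opens} (l : Γ(L, U)) (n : Γ(N, U)) :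
    Γ(X, U) := asFun (e.app U (tensorSec l n))

variable (e : sheafTensor L N ⟶ structureModule X)

theorem pairing_add_right {U : X.Opens} (l : Γ(L, U)) (n n' : Γ(N, U)) :
    pairing e l (n + n') = pairing e l n + pairing e l n' := by
  rw [pairing, tensorSec_add_right, map_add]
  rfl

theorem pairing_smul_left {U : X.Opens} (r : Γ(X, U)) (l : Γ(L, U)) (n : Γ(N, U)) :
    pairing e (r • l) n = r * pairing e l n := by
  rw [pairing, tensorSec_smul_left, Scheme.Modules.Hom.app_smul]
  rfl

theorem pairing_smul_right {U : X.Opens} (r : Γ(X, U)) (l : Γ(L, U)) (n : Γ(N, U)) :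
    pairing e l (r • n) = r * pairing e l n := by
  rw [pairing, tensorSec_smul_right, Scheme.Modules.Hom.app_smul]
  rfl

theorem funRes_pairing {W U : X.Opens} (h : W ≤ U) (l : Γ(L, U)) (n : Γ(N, U)) :
    funRes X h (pairing e l n) = pairing e (secRes L h l) (secRes N h n) := by
  rw [pairing, pairing, ← asFun_secRes, ← hom_secRes, secRes_tensorSec]

/-- The pairing is not identically zero, as it is an isomorphism. A pair with nonzero value, with
its first entry written as a multiple of `l`, gives a nonzero function `a`, which is invertible on
its basic open set. -/
theorem exists_isUnit_pairing [IsIntegral X] (e : sheafTensor L N ≅ structureModule X)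
    {W : X.Opens} (hW : (W : Set X).Nonempty) {l : Γ(L, W)} (hl : IsFrame l) :
    ∃ (U : X.Opens) (hU : U ≤ W) (n : Γ(N, U)), (U : Set X).Nonempty ∧
      IsUnit (pairing e.hom (secRes L hU l) n) := by
  obtain ⟨U, l', n, hne⟩ : ∃ (U : X.Opens) (l' : Γ(L, U)) (n : Γ(N, U)),
      pairing e.hom l' n ≠ 0 := by
    by_contra! h
    have h0 : e.hom = 0 := tensor_hom_ext fun U x y => h U x y
    have h1 : 𝟙 (structureModule X) = 0 := by
      rw [← e.inv_hom_id, h0, Limits.comp_zero]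
    have h2 := congrArg (fun f => asFun (Scheme.Modules.Hom.app f ⊤ (asSec 1))) h1
    have : Nonempty (⊤ : X.Opens) := ⟨⟨hW.some, trivial⟩⟩
    exact one_ne_zero (α := Γ(X, ⊤)) h2
  have hU : (U : Set X).Nonempty := by
    by_contra hU
    refine hne (fun_ext fun p hp => ?_)
    exact absurd ⟨p, hp⟩ hU
  have hUW := inter_nonempty hU hW
  obtain ⟨c, hc⟩ := (hl.restrict (inf_le_right : U ⊓ W ≤ W)).exists_eq (secRes L inf_le_left l')
  let a := pairing e.hom (secRes L (inf_le_right : U ⊓ W ≤ W) l) (secRes N inf_le_left n)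
  have ha : a ≠ 0 := by
    intro ha
    refine hne (funRes_injective (inf_le_left : U ⊓ W ≤ U) hUW ?_)
    rw [funRes_pairing, hc, pairing_smul_left, map_zero]
    exact mul_eq_zero_of_right _ ha
  have hle : X.basicOpen a ≤ U ⊓ W := X.basicOpen_le a
  refine ⟨X.basicOpen a, hle.trans inf_le_right, secRes N (hle.trans inf_le_left) n, ?_, ?_⟩
  · by_contra h
    rw [Set.not_nonempty_iff_eq_empty] at h
    refine ha ((basicOpen_eq_bot_iff a).mp ?_)
    exact TopologicalSpace.Opens.ext h
  · have h := RingedSpace.isUnit_res_basicOpen X.toRingedSpace a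
    have h2 : funRes X hle a = pairing e.hom (secRes L (hle.trans inf_le_right) l)
        (secRes N (hle.trans inf_le_left) n) := by
      rw [funRes_pairing, secRes_secRes, secRes_secRes]
    rw [← h2]
    exact h

end

/-! ### From global generation to sections on the total space -/

section

variable {X V : Scheme.{u}} {π : V ⟶ X}

theorem hom_eq_of_generatingSections {C : Type u} [Category.{u} C] {J : GrothendieckTopology C}
    {R : Sheaf J RingCat.{u}} [HasWeakSheafify J AddCommGrpCat.{u}]
    [J.WEqualsLocallyBijective AddCommGrpCat.{u}] {M N : SheafOfModules.{u} R}
    (σ : M.GeneratingSections) (h : ∀ f g : SheafOfModules.unit R ⟶ N, f = g) (β β' : M ⟶ N) :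
    β = β' := by
  have h0 : σ.π ≫ β = σ.π ≫ β' :=
    Limits.Cofan.IsColimit.hom_ext (SheafOfModules.isColimitFreeCofan _) _ _ fun _ => h _ _
  have := σ.epi
  exact (cancel_epi σ.π).mp h0

/-- If `G` had no nonzero global section, every morphism from the structure sheaf to `G` would be
zero, hence every morphism from a free module, hence every morphism from its quotient `F`. -/
theorem exists_section_ne_zero {F G : X.Modules} (hF : IsGloballyGenerated F) {β : F ⟶ G}
    (hβ : β ≠ 0) : ∃ g : Γ(G, ⊤), g ≠ 0 := by
  by_contra! h
  obtain ⟨σ⟩ := hF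
  have hunit : ∀ f g : structureModule X ⟶ G, f = g := fun f g => modules_hom_ext fun U x => by
    have h1 : x = asFun x • secRes (structureModule X) le_top (asSec (1 : Γ(X, ⊤))) := by
      rw [secRes_asSec, map_one, smul_asSec, mul_one, asSec_asFun]
    have h2 : f.app ⊤ (asSec 1) = g.app ⊤ (asSec 1) := (h _).trans (h _).symm
    rw [h1, Scheme.Modules.Hom.app_smul, hom_secRes, h2, Scheme.Modules.Hom.app_smul, hom_secRes]
  let z : F ⟶ G := 0
  exact hβ (hom_eq_of_generatingSections (R := X.ringCatSheaf) σ hunit β z)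

theorem exists_tensor_pushforward_hom {M N : X.Modules} {P : V.Modules}
    (ψ : M ⟶ (Scheme.Modules.pushforward π).obj P)
    (φ : N ⟶ (Scheme.Modules.pushforward π).obj (structureModule V)) :
    ∃ β : sheafTensor M N ⟶ (Scheme.Modules.pushforward π).obj P,
      ∀ (U : X.Opens) (x : Γ(M, U)) (y : Γ(N, U)),
        pushSec β (tensorSec x y) = asFun (pushSec φ y) • pushSec ψ x := by
  refine exists_tensor_hom (P := (Scheme.Modules.pushforward π).obj P)
    (fun U x y => (show Γ(P, π ⁻¹ᵁ U) from asFun (pushSec φ y) • pushSec ψ x))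
    (fun U x x' y => ?_) (fun U r x y => ?_) (fun U x y y' => ?_) (fun U r x y => ?_)
    (fun W U h x y => ?_)
  · change asFun (pushSec φ y) • pushSec ψ (x + x') =
      asFun (pushSec φ y) • pushSec ψ x + asFun (pushSec φ y) • pushSec ψ x'
    rw [pushSec_add, smul_add]
  · change asFun (pushSec φ y) • pushSec ψ (r • x) =
      π.app U r • asFun (pushSec φ y) • pushSec ψ x
    rw [pushSec_smul, smul_comm]
  · change asFun (pushSec φ (y + y')) • pushSec ψ x =
      asFun (pushSec φ y) • pushSec ψ x + asFun (pushSec φ y') • pushSec ψ x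
    rw [pushSec_add, asFun_add, add_smul]
  · change asFun (pushSec φ (r • y)) • pushSec ψ x =
      π.app U r • asFun (pushSec φ y) • pushSec ψ x
    rw [pushSec_smul, asFun_smul, mul_smul]
  · change asFun (pushSec φ (secRes N h y)) • pushSec ψ (secRes M h x) =
      secRes P (π.preimage_mono h) (asFun (pushSec φ y) • pushSec ψ x)
    rw [secRes_smul, ← secRes_pushSec, ← secRes_pushSec, asFun_secRes]

/-- The multiplicative extension of `α` to tensor powers. The section `y` is the tensor power of
`n`; only its value is recorded, as this is enough to prove that morphisms are nonzero. -/
theorem exists_tensorPow_pushforward_hom {N : X.Modules}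
    (α : N ⟶ (Scheme.Modules.pushforward π).obj (structureModule V)) (r : ℕ) :
    ∃ β : sheafTensorPow N r ⟶ (Scheme.Modules.pushforward π).obj (structureModule V),
      ∀ (U : X.Opens) (n : Γ(N, U)), ∃ y : Γ(sheafTensorPow N r, U),
        asFun (pushSec β y) = asFun (pushSec α n) ^ r := by
  induction r with
  | zero =>
    -- For `r = 0` the morphism is the pullback of functions along `π`.
    refine ⟨homToPushforward π (M := structureModule X)
      (fun W x => asSec (π.app W (asFun x))) (fun W x y => ?_) (fun W r x => ?_)
      (fun W T h x => ?_), fun U n => ⟨asSec (X := X) 1, ?_⟩⟩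
    · rw [asFun_add, map_add]
      rfl
    · rw [asFun_smul, map_mul, smul_asSec]
    · rw [asFun_secRes, secRes_asSec, funRes_app π h]
    · rw [pow_zero]
      exact map_one (π.app U).hom
  | succ r ih =>
    obtain ⟨β, hβ⟩ := ih
    obtain ⟨β', hβ'⟩ := exists_tensor_pushforward_hom β α
    refine ⟨β', fun U n => ?_⟩
    obtain ⟨y, hy⟩ := hβ U n
    refine ⟨tensorSec y n, ?_⟩
    have h := congrArg asFun (hβ' U y n)
    rw [asFun_smul, hy] at h
    rw [pow_succ', ← h]
    rfl

variable {L N : X.Modules} {s : Γ((Scheme.Modules.pullback π).obj L, ⊤)}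

theorem localCoord_pullbackLocal {M : X.Modules} {U : X.Opens} {m : Γ(M, U)} (hm : IsFrame m)
    {W : X.Opens} (x : Γ(M, W)) :
    localCoord (hm.pullbackLocal π) (pullbackLocal π x) = pullbackCoord π hm x :=
  IsFrame.coord_eq _ (pullbackCoord_smul π hm x).symm

/-- Sections of the dual of `L` are functions on `V`, linear on the fibres: `n` goes to the pairing
of `n` with `s`. The formula is imposed over W₀ and extends because it has the same shape in every
frame of `L`. -/
theorem exists_pairing_pushforward_hom [IsIntegral V] (hL : HasFrames L)
    (e : sheafTensor L N ⟶ structureModule X) {W₀ : X.Opens}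
    (hW₀ : ((π ⁻¹ᵁ W₀ : V.Opens) : Set V).Nonempty) {l₀ : Γ(L, W₀)} (hl₀ : IsFrame l₀)
    {t₀ : Γ(V, π ⁻¹ᵁ W₀)} (ht₀ : secRes _ le_top s = t₀ • pullbackLocal π l₀) :
    ∃ α : N ⟶ (Scheme.Modules.pushforward π).obj (structureModule V),
      ∀ (U : X.Opens) (hU : U ≤ W₀) (n : Γ(N, U)), asFun (pushSec α n) =
        funRes V (π.preimage_mono hU) t₀ * π.app U (pairing e (secRes L hU l₀) n) := by
  obtain ⟨α, hα⟩ := exists_pushforward_hom (π := π) (K := N) (P := structureModule V)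
    torsionFree_structureModule hW₀
    (fun U n => asSec (funRes V (openPart_le_left (π ⁻¹ᵁ W₀) (π ⁻¹ᵁ U)) t₀ *
      funRes V (preimage_le_openPart π W₀ U) (π.app _ (pairing e
        (secRes L (openPart_le_left W₀ U) l₀) (secRes N (openPart_le_right W₀ U) n)))))
    (fun U x y => by
      rw [map_add, pairing_add_right, map_add, map_add, mul_add]
      rfl)
    (fun U r x => by
      rw [secRes_smul, pairing_smul_right, map_mul, map_mul, smul_asSec, mul_left_comm,
        ← funRes_app π (openPart_le_right W₀ U) (π.preimage_mono (openPart_le_right W₀ U)),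
        funRes_funRes])
    (fun U T h x => by
      rw [secRes_asSec, map_mul, funRes_funRes, funRes_funRes]
      refine congrArg (fun a => asSec (_ * a)) ?_
      have h2 : pairing e (secRes L (openPart_le_left W₀ U) l₀)
          (secRes N (openPart_le_right W₀ U) (secRes N h x)) = funRes X (openPart_mono W₀ h)
          (pairing e (secRes L (openPart_le_left W₀ T) l₀) (secRes N (openPart_le_right W₀ T) x)) := by
        rw [funRes_pairing, secRes_secRes, secRes_secRes, secRes_secRes]
      rw [h2, ← funRes_app π (openPart_mono W₀ h) (π.preimage_mono (openPart_mono W₀ h)),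
        funRes_funRes])
    (fun U n p hp => by
      obtain ⟨W, l, hpW, hWU, hl⟩ := hL.exists_le (show π p ∈ U from hp)
      obtain ⟨t, ht⟩ := (hl.pullbackLocal π).exists_eq (secRes _ le_top s)
      refine ⟨π ⁻¹ᵁ W, π.preimage_mono hWU, hpW,
        asSec (t * π.app W (pairing e l (secRes N hWU n))), ?_⟩
      obtain ⟨c, hc⟩ := (hl₀.restrict (openPart_le_left W₀ W)).exists_eq
        (secRes L (openPart_le_right W₀ W) l)
      have hpre := preimage_le_openPart π W₀ W
      have h1 : secRes _ (openPart_le_right (π ⁻¹ᵁ W₀) (π ⁻¹ᵁ W)) (pullbackLocal π l) =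
          funRes V hpre (π.app _ c) • secRes _ (openPart_le_left (π ⁻¹ᵁ W₀) (π ⁻¹ᵁ W))
            (pullbackLocal π l₀) := by
        rw [← secRes_secRes hpre (π.preimage_mono (openPart_le_right W₀ W)),
          ← secRes_secRes hpre (π.preimage_mono (openPart_le_left W₀ W)),
          secRes_pullbackLocal π (openPart_le_right W₀ W), hc, pullbackLocal_smul, secRes_smul,
          secRes_pullbackLocal π (openPart_le_left W₀ W)]
      -- From `l = c • l₀` the coordinates of `s` are related by `t₀ = t * c`; the pairings in `h3`
      -- change by `c` in the opposite way.
      have h2 : funRes V (openPart_le_left (π ⁻¹ᵁ W₀) (π ⁻¹ᵁ W)) t₀ =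
          funRes V (openPart_le_right (π ⁻¹ᵁ W₀) (π ⁻¹ᵁ W)) t * funRes V hpre (π.app _ c) := by
        refine ((hl₀.pullbackLocal π).restrict
          (openPart_le_left (π ⁻¹ᵁ W₀) (π ⁻¹ᵁ W))).smul_inj ?_
        rw [← secRes_smul, ← ht₀, mul_smul, ← h1, ← secRes_smul, ← ht, secRes_secRes, secRes_secRes]
      have h3 : funRes V (openPart_le_right (π ⁻¹ᵁ W₀) (π ⁻¹ᵁ W))
          (π.app W (pairing e l (secRes N hWU n))) = funRes V hpre (π.app _ c) *
          funRes V hpre (π.app _ (pairing e (secRes L (openPart_le_left W₀ W) l₀)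
            (secRes N (openPart_le_right W₀ W) (secRes N hWU n)))) := by
        rw [← map_mul, ← map_mul, ← pairing_smul_left, ← hc, ← funRes_pairing,
          ← funRes_app π (openPart_le_right W₀ W) (π.preimage_mono (openPart_le_right W₀ W)),
          funRes_funRes]
      have h4 : pairing e (secRes L (openPart_le_left W₀ W) l₀)
          (secRes N (openPart_le_right W₀ W) (secRes N hWU n)) = funRes X (openPart_mono W₀ hWU)
          (pairing e (secRes L (openPart_le_left W₀ U) l₀)
            (secRes N (openPart_le_right W₀ U) n)) := by
        rw [funRes_pairing, secRes_secRes, secRes_secRes, secRes_secRes]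
      rw [secRes_asSec, secRes_asSec, map_mul, map_mul, funRes_funRes, funRes_funRes, h2, mul_assoc,
        h3, h4, ← funRes_app π (openPart_mono W₀ hWU) (π.preimage_mono (openPart_mono W₀ hWU)),
        funRes_funRes])
  refine ⟨α, fun U hU n => ?_⟩
  refine funRes_openPart_injective hW₀ (π ⁻¹ᵁ U) ?_
  refine (congrArg asFun (hα U n)).trans ?_
  have h1 : funRes X (openPart_le_right W₀ U) (pairing e (secRes L hU l₀) n) =
      pairing e (secRes L (openPart_le_left W₀ U) l₀) (secRes N (openPart_le_right W₀ U) n) := by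
    rw [funRes_pairing, secRes_secRes]
  rw [asFun_asSec, map_mul, funRes_funRes, ← h1,
    ← funRes_app π (openPart_le_right W₀ U) (π.preimage_mono (openPart_le_right W₀ U)),
    funRes_funRes]

/-- This is pullback of local morphisms: the pullback of `h` sends the pullback of `m` to the
pullback of the image of `m`. That it is defined on all sections is checked in local frames of `M`.
-/
theorem exists_homSheaf_pushforward_hom [IsIntegral X] [IsIntegral V] {M M' : X.Modules}
    (hM : HasFrames M) (hM' : TorsionFree M')
    (hP : TorsionFree ((Scheme.Modules.pullback π).obj M')) {U₀ : X.Opens} {m : Γ(M, U₀)}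
    (hm : IsFrame m) (hU₀ : (U₀ : Set X).Nonempty)
    (hU₀' : ((π ⁻¹ᵁ U₀ : V.Opens) : Set V).Nonempty) :
    ∃ γ : homSheaf hm hM' hU₀ ⟶
        (Scheme.Modules.pushforward π).obj (homSheaf (hm.pullbackLocal π) hP hU₀'),
      ∀ (U : X.Opens) (h : Γ(homSheaf hm hM' hU₀, U)),
        ofExtend ((frameImage (hm.pullbackLocal π) hP hU₀').app (π ⁻¹ᵁ U) (pushSec γ h)) =
          secRes _ (preimage_le_openPart π U₀ U)
            (pullbackLocal π (ofExtend ((frameImage hm hM' hU₀).app U h))) := by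
  have hex : ∀ (U : X.Opens) (h : Γ(homSheaf hm hM' hU₀, U)), IsFrameImage (hm.pullbackLocal π)
      (π ⁻¹ᵁ U) (toExtend (secRes _ (preimage_le_openPart π U₀ U)
            (pullbackLocal π (ofExtend ((frameImage hm hM' hU₀).app U h))))) := by
    intro U h
    refine isFrameImage_of_local _ hP hU₀' fun p hp => ?_
    obtain ⟨W, e, hpW, hWU, he⟩ := hM.exists_le (show π p ∈ U from hp)
    obtain ⟨z, hz⟩ := isFrameImage_frameImage hm hM' hU₀ h W hWU e
    refine ⟨π ⁻¹ᵁ W, π.preimage_mono hWU, hpW,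
      isFrameImage_of_frame _ (he.pullbackLocal π) (z := pullbackLocal π z) ?_⟩
    rw [localCoord_pullbackLocal, secRes_ofExtend, ofExtend_toExtend, secRes_secRes,
      ← secRes_secRes (preimage_le_openPart π U₀ W) (π.preimage_mono (openPart_le_right U₀ W)),
      secRes_pullbackLocal π (openPart_le_right U₀ W), hz, pullbackLocal_smul, secRes_smul,
      ← secRes_pullbackLocal π (openPart_mono U₀ hWU) (π.preimage_mono (openPart_mono U₀ hWU)),
      secRes_secRes]
    rfl
  choose k hk using fun U h => (exists_frameImage_eq_iff (hm.pullbackLocal π) hP hU₀' _).mpr (hex U h)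
  refine ⟨homToPushforward π k (fun W x y => ?_) (fun W r x => ?_) (fun W T h x => ?_),
    fun U h => congrArg ofExtend (hk U h)⟩
  · refine frameImage_injective (hm.pullbackLocal π) hP hU₀' _ (ofExtend_injective ?_)
    rw [map_add, hk, hk, hk, map_add, ofExtend_add, pullbackLocal_add, map_add]
    rfl
  · refine frameImage_injective (hm.pullbackLocal π) hP hU₀' _ (ofExtend_injective ?_)
    rw [Scheme.Modules.Hom.app_smul, hk, hk, Scheme.Modules.Hom.app_smul, ofExtend_smul,
      ofExtend_smul, pullbackLocal_smul, ofExtend_toExtend, ofExtend_toExtend, secRes_smul,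
      ← funRes_app π (openPart_le_right U₀ W) (π.preimage_mono (openPart_le_right U₀ W)),
      funRes_funRes]
  · refine frameImage_injective (hm.pullbackLocal π) hP hU₀' _ (ofExtend_injective ?_)
    rw [hom_secRes, hk, hk, hom_secRes, secRes_ofExtend, secRes_ofExtend, ofExtend_toExtend,
      ofExtend_toExtend, secRes_secRes,
      ← secRes_pullbackLocal π (openPart_mono U₀ h) (π.preimage_mono (openPart_mono U₀ h)),
      secRes_secRes]

end

/-! ### The main theorem -/

/-- Morphisms from M to M' ⊗ L^(-r) give morphisms between the pullbacks after multiplication by the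
r-th power of the tautological section, and ampleness of the inverse of `L` provides nonzero ones.
-/
theorem exists_pullback_hom_ne_zero {X V : Scheme.{u}} [IsIntegral X] {π : V ⟶ X} {L : X.Modules}
    {s : Γ((Scheme.Modules.pullback π).obj L, ⊤)} (hV : IsTotalSpace L π s) (hL : HasFrames L)
    (hample : HasAmpleInverse L) {M M' : X.Modules} (hM : HasFrames M) (hM' : HasFrames M') :
    ∃ φ : (Scheme.Modules.pullback π).obj M ⟶ (Scheme.Modules.pullback π).obj M', φ ≠ 0 := by
  have := hV.isIntegral hL
  obtain ⟨N, ⟨e⟩, -, hgen⟩ := hample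
  obtain ⟨p⟩ := (inferInstance : Nonempty X)
  obtain ⟨W₀, l₀, hpW, hl₀⟩ := hL p
  obtain ⟨t₀, ht₀⟩ := (hl₀.pullbackLocal π).exists_eq (secRes _ le_top s)
  obtain ⟨ht₀_ne, hW₀⟩ := hV.ne_zero ⟨p, hpW⟩ hl₀ ht₀
  obtain ⟨α, hα⟩ := exists_pairing_pushforward_hom hL e.hom hW₀ hl₀ ht₀
  obtain ⟨U₁, hU₁, n₁, ⟨q, hq₁⟩, hn₁⟩ := exists_isUnit_pairing e ⟨p, hpW⟩ hl₀
  obtain ⟨U₂, m₂, hq₂, hU₂, hm₂⟩ := hM.exists_le hq₁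
  obtain ⟨U, m', hq, hU, hm'⟩ := hM'.exists_le hq₂
  have hm := hm₂.restrict hU
  have hUW : U ≤ W₀ := hU.trans (hU₂.trans hU₁)
  have hne : (U : Set X).Nonempty := ⟨q, hq⟩
  have hne' : ((π ⁻¹ᵁ U : V.Opens) : Set V).Nonempty := by
    obtain ⟨t, ht⟩ := ((hl₀.restrict hUW).pullbackLocal π).exists_eq (secRes _ le_top s)
    exact (hV.ne_zero hne (hl₀.restrict hUW) ht).2
  have hP := (hM'.pullback π).torsionFree
  -- The sheaf of morphisms from `M` to `M'` has local frames, so it is coherent and ampleness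
  -- applies to it.
  obtain ⟨r, hr⟩ := hgen _ (hasFrames_homSheaf hm hM'.torsionFree hne hM hM').isCoherentModule
  obtain ⟨γ, hγ⟩ := exists_homSheaf_pushforward_hom hM hM'.torsionFree hP hm hne hne'
  obtain ⟨α', hα'⟩ := exists_tensorPow_pushforward_hom α r
  obtain ⟨β, hβ⟩ := exists_tensor_pushforward_hom γ α'
  -- Test sections on which `β` does not vanish: `y` maps to a power of `t₀` times a unit, and `h`
  -- below is the local morphism from the frame of `M` to that of `M'`.
  obtain ⟨y, hy⟩ := hα' U (secRes N (hU.trans hU₂) n₁)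
  have := isDomain_sections hne'
  have hy0 : asFun (pushSec α' y) ≠ 0 := by
    rw [hy, hα U hUW]
    refine pow_ne_zero _ (mul_ne_zero ?_ ?_)
    · rw [← map_zero (funRes V (π.preimage_mono hUW))]
      exact fun h => ht₀_ne (funRes_injective _ hne' h)
    · have h1 : pairing e.hom (secRes L hUW l₀) (secRes N (hU.trans hU₂) n₁) =
          funRes X (hU.trans hU₂) (pairing e.hom (secRes L hU₁ l₀) n₁) := by
        rw [funRes_pairing, secRes_secRes]
      rw [h1]
      exact ((hn₁.map _).map (π.app U).hom).ne_zero
  have hone : localCoord hm (secRes M hU m₂) = 1 := IsFrame.coord_eq _ (one_smul _ _).symm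
  obtain ⟨h, hh⟩ := (exists_frameImage_eq_iff hm hM'.torsionFree hne
    (toExtend (secRes M' (openPart_le_right U U) m'))).mpr
      (isFrameImage_of_frame hm hm (z := m') (by rw [hone, one_smul, ofExtend_toExtend]))
  have hh0 : pushSec γ h ≠ 0 := by
    intro h0
    have h1 := hγ U h
    rw [h0, map_zero, ofExtend_zero, hh, ofExtend_toExtend] at h1
    have hfr := ((hm'.restrict (openPart_le_right U U)).pullbackLocal π).restrict
      (preimage_le_openPart π U U)
    have : Nonempty (openPart (π ⁻¹ᵁ U) (π ⁻¹ᵁ U)) := by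
      obtain ⟨v, hv⟩ := hne'
      exact ⟨⟨v, le_openPart le_rfl le_rfl hv⟩⟩
    refine one_ne_zero (α := Γ(V, openPart (π ⁻¹ᵁ U) (π ⁻¹ᵁ U))) (hfr.smul_inj ?_)
    rw [one_smul, zero_smul]
    exact h1.symm
  have hβ0 : β ≠ 0 := by
    rintro rfl
    have h1 := hβ U h y
    rcases smul_eq_zero_of_hasFrames (hasFrames_homSheaf (hm.pullbackLocal π) hP hne'
      (hM.pullback π) (hM'.pullback π)) h1.symm with h2 | h2
    · exact hy0 h2
    · exact hh0 h2
  obtain ⟨g, hg⟩ := exists_section_ne_zero (hr r le_rfl) hβ0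
  exact exists_hom_ne_zero (hm.pullbackLocal π) hP hne' (h := g) hg

theorem theorem3 {k : Type u} [Field k] [IsAlgClosed k]
    (X : Scheme.{u}) [X.Over (Spec (.of k))] [IsIntegral X] [Smooth (X ↘ Spec (.of k))]
    (hX : IsProjectiveOver k X)
    (n : ℕ) (hn : 0 < n) (E : Fin n → X.Modules) (L : X.Modules)
    (hE : ∀ i, IsLineBundle (E i)) (hL : IsLineBundle L)
    (hEL : GeneratesSimpleSpiral k E L)
    (V : Scheme.{u}) [V.Over (Spec (.of k))] (π : V ⟶ X) [π.IsOver (Spec (.of k))]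
    (s : Γ((Scheme.Modules.pullback π).obj L, ⊤)) (hV : IsTotalSpace L π s)
    (Q : QuiverPresentation k fun i => (Scheme.Modules.pullback π).obj (E i)) :
    ∃ φ₀ : affinization V ⟶ Q.affineQuotient,
      IsTautologicalMap Q φ₀ ∧
      (∀ φ : affinization V ⟶ Q.affineQuotient, IsTautologicalMap Q φ → φ = φ₀) ∧
      ∃ U : (affinization V).Opens, Dense (U : Set (affinization V)) ∧
        IsOpenImmersion (U.ι ≫ φ₀) := by
  have hLf := hL.hasFrames
  have := hV.isIntegral hLf
  have : Infinite k := IsAlgClosed.instInfinite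
  have hframes : ∀ i, HasFrames ((Scheme.Modules.pullback π).obj (E i)) :=
    fun i => (hE i).hasFrames.pullback π
  have hhom : ∀ i j, ∃ f : (Scheme.Modules.pullback π).obj (E j) ⟶
      (Scheme.Modules.pullback π).obj (E i), f ≠ 0 := fun i j =>
    exists_pullback_hom_ne_zero hV hLf hEL.ample (hE j).hasFrames (hE i).hasFrames
  obtain ⟨T, hT, hTuniq⟩ := Q.existsUnique_isTautologicalPullback hframes
  refine ⟨Spec.map (CommRingCat.ofHom T), ⟨T, hT, rfl⟩, ?_, ?_⟩
  · rintro φ ⟨T', hT', rfl⟩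
    rw [hTuniq T' hT']
  -- Any node will do as reference.
  · let i : Fin n := ⟨0, hn⟩
    have hTi := Q.pullback_nodeFunction hframes hT i
    obtain ⟨u, hu, hmul⟩ := Q.exists_mul_eq hframes i hhom hT
    have : IsDomain Γ(V, ⊤) := isDomain_sections ⟨(Classical.arbitrary V : V), trivial⟩
    refine exists_dense_isOpenImmersion (R := .of Q.invariants) (S := Γ(V, ⊤))
      (CommRingCat.ofHom T) (fun b => ⟨_, hTi b⟩) (Q.nodeFunction i u) ?_ fun x hx => ?_
    · intro h
      exact hu ((hTi u).symm.trans h)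
    -- By `hmul` the product of the invariant of `u` with `x` depends on `T x` only.
    · have h0 : T x = 0 := hx
      have h1 : Q.nodeFunction i (0 : Γ(V, ⊤)) = 0 := by
        have h := Q.nodeFunction_scalar i 0
        rw [map_zero, map_zero] at h
        exact h
      rw [hmul, h0, h1, mul_zero]

end
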